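/- **Setting.** Let $G=(V,E)$ be a finite weighted undirected graph, $n=|V|$, with weights $w\ge 0$, all weighted degrees equal to $1$, and lazy: $w(x,x)\ge\frac12$ for every vertex $x$. Write $w(S,T)=\sum_{x\in S,\,y\in T}w(x,y)$. For $\emptyset\ne S\subseteq V$ let $$\phi(S)=\frac{w(S,V\setminus S)}{|S|},\qquad N_{1/2}(S)=\min\{|T| : T\subseteq V\setminus S,\ w(S,T)\ge \tfrac12 w(S,V\setminus S)\},$$ $$\phi^V(S)=\min\{N_{1/2}(S)/|S|,\,1\},\qquad \Psi(S)=\phi(S)\,\phi^V(S).$$ Let $\Delta$ be the largest number of neighbours of a vertex (a self-loop makes a vertex a neighbour of itself). **Algorithm.** The evolving set process moves from $S$ to $\tilde S=\{y: w(\{y\},S)\ge U\}$ with $U$ uniform in $[0,1]$; its volume-biased version moves from $S\neq\emptyset$ to $S'$ with probability $\frac{|S'|}{|S|}\Pr[\tilde S=S']$. Given a start vertex $v$, parameters $k\ge1$, $\varphi>0$, $\epsilon>0$ and numerical constants $c,C>0$, the evolving set algorithm runs, one after the other, up to $\lceil Ck^{\epsilon}\rceil$ independent copies of the volume-biased process from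 $\{v\}$, each for at most $\lceil c(1+\epsilon\log k)/\varphi\rceil$ steps. It returns the first set $S$ it meets with $|S|\le Ck^{1+\epsilon}$ and $\Psi(S)\le C\varphi/\epsilon$; a copy is abandoned when its set would get larger than $Ck^{1+\epsilon}$. **Running time.** The values $w(\{y\},S)>0$ of the current set $S$ are kept in balanced search trees, and one tree operation costs $\lfloor\log_2 n\rfloor+1$. When a copy starts, and whenever its set changes, one operation is charged for each neighbour of each vertex that enters or leaves the set, and one more for drawing the change together with the number of idle steps before it and for evaluating the new set. A step in which the copy is abandoned costs one operation. **Statement.** For every $\epsilon_0>0$ there are constants $c,C,D,p>0$ such that the following holds for all such $G$, every target set $S^*\subseteq V$ with $S^*\neq\emptyset$ and $\phi(S^*)>0$, and every $0<\epsilon\le\epsilon_0$. There is a subset $S'\subseteq S^*$ with $|S'|\ge|S^*|/2$ such that for every $v\in S'$, with probability at least $p$, the evolving set algorithm with start vertex $v$, $k=|S^*|$ and $\varphi=\phi(S^*)$ returns a non-empty set $S$ with $$\Psi(S)\le C\,\frac{\phi(S^*)}{\epsilon},\qquad |S|\le C\,|S^*|^{1+\epsilon},$$ and its running time is at most $D\,\Delta\,|S^*|^{1+2\epsilon}\,\phi(S^*)^{-1/2}\log^2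 n$. -/

import Mathlib

open scoped ENNReal
open MeasureTheory

noncomputable section

/-- A weighted undirected graph on `V` (self-loops allowed), regular, with the weights scaled so
that every weighted degree is `1`.  `w i j` is the weight of the edge `ij` (`0` for a non-edge); it
is also the transition matrix of the random walk. -/
structure RegularGraph (V : Type*) [Fintype V] where
  w : V → V → ℝ
  nonneg : ∀ i j, 0 ≤ w i j
  symm : ∀ i j, w i j = w j i
  degree_eq_one : ∀ i, ∑ j, w i j = 1

namespace RegularGraph

variable {V : Type*} [Fintype V] (G : RegularGraph V)

/-- The graph is lazy: every vertex carries a self-loop of weight at least `1/2`. -/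
def IsLazy : Prop := ∀ i, 1 / 2 ≤ G.w i i

/-- `w(S, T)`: the total weight between `S` and `T`
(used only for disjoint `S`, `T`, or with `S` a single vertex). -/
def weight (S T : Finset V) : ℝ := ∑ i ∈ S, ∑ j ∈ T, G.w i j

lemma weight_singleton_nonneg (y : V) (S : Finset V) : 0 ≤ G.weight {y} S := by
  simpa [weight] using Finset.sum_nonneg fun j _ => G.nonneg y j

lemma weight_singleton_le_one (y : V) (S : Finset V) : G.weight {y} S ≤ 1 := by
  rw [← G.degree_eq_one y]
  simpa [weight] using
    Finset.sum_le_univ_sum_of_nonneg (s := S) (fun j => G.nonneg y j)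

lemma sum_weight_singleton (S : Finset V) : ∑ y, G.weight {y} S = S.card := by
  simp only [weight, Finset.sum_singleton]
  rw [Finset.sum_comm]
  have : ∀ j ∈ S, ∑ i, G.w i j = 1 := fun j _ => by
    rw [← G.degree_eq_one j]
    exact Finset.sum_congr rfl fun i _ => G.symm i j
  rw [Finset.sum_congr rfl this]
  simp

variable [DecidableEq V]

/-- The expansion `φ(S) = w(S, V - S) / |S|`. -/
def expansion (S : Finset V) : ℝ := G.weight S Sᶜ / (S.card : ℝ)

/-- `N_{1/2}(S)`: the least size of a set `T ⊆ V - S` that receives at least half of the weight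
leaving `S`.  (The set of candidates contains `|V - S|`, so the infimum is a minimum.) -/
def halfBoundary (S : Finset V) : ℕ :=
  sInf {m : ℕ | ∃ T : Finset V, T ⊆ Sᶜ ∧ T.card = m ∧ G.weight S Sᶜ / 2 ≤ G.weight S T}

/-- The robust vertex expansion `φ^V(S) = min {N_{1/2}(S) / |S|, 1}`. -/
def vertexExpansion (S : Finset V) : ℝ := min ((G.halfBoundary S : ℝ) / (S.card : ℝ)) 1

/-- `Ψ(S) = φ(S) φ^V(S)`. -/
def Psi (S : Finset V) : ℝ := G.expansion S * G.vertexExpansion S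

/-! ### The evolving set process -/

/-- The set that follows `S` for the threshold `u`: all `y` with `w(y, S) ≥ u`. -/
def nextSet (S : Finset V) (u : ℝ) : Finset V :=
  Finset.univ.filter fun y => u ≤ G.weight {y} S

/-- Transition probability of the evolving set process:
the probability that `nextSet S U = S'` for `U` uniform in `[0, 1]`. -/
def espKernel (S S' : Finset V) : ℝ≥0∞ :=
  volume {u : ℝ | u ∈ Set.Icc 0 1 ∧ G.nextSet S u = S'}

lemma measurableSet_nextSet_eq (S S' : Finset V) :
    MeasurableSet {u : ℝ | u ∈ Set.Icc (0 : ℝ) 1 ∧ G.nextSet S u = S'} := by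
  refine MeasurableSet.inter measurableSet_Icc ?_
  have h : {u : ℝ | G.nextSet S u = S'} = ⋂ y : V, {u : ℝ | u ≤ G.weight {y} S ↔ y ∈ S'} := by
    ext u
    simp [nextSet, Finset.ext_iff]
  change MeasurableSet {u : ℝ | G.nextSet S u = S'}
  rw [h]
  refine MeasurableSet.iInter fun y => ?_
  by_cases hy : y ∈ S'
  · simp only [hy, iff_true]
    exact measurableSet_Iic
  · simp only [hy, iff_false, not_le]
    exact measurableSet_Ioi

/-- The expected size of the next set is the size of the present one. -/
lemma sum_card_mul_espKernel (S : Finset V) :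
    ∑ S' : Finset V, (S'.card : ℝ≥0∞) * G.espKernel S S' = S.card := by
  have h1 : ∀ y : V, ∑ S' : Finset V with y ∈ S', G.espKernel S S' =
      ENNReal.ofReal (G.weight {y} S) := by
    intro y
    unfold espKernel
    rw [← measure_biUnion_finset]
    · have : (⋃ S' ∈ Finset.univ.filter (fun S' : Finset V => y ∈ S'),
          {u : ℝ | u ∈ Set.Icc (0 : ℝ) 1 ∧ G.nextSet S u = S'}) =
          Set.Icc 0 (G.weight {y} S) := by
        ext u
        have := G.weight_singleton_le_one y S
        simp only [Finset.mem_filter, Finset.mem_univ, true_and, Set.mem_iUnion, Set.mem_ofPred_eq,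
          exists_prop, Set.mem_Icc]
        constructor
        · rintro ⟨S', hy, ⟨h0, _⟩, rfl⟩
          exact ⟨h0, by simpa [nextSet] using hy⟩
        · rintro ⟨h0, hu⟩
          exact ⟨_, by simpa [nextSet] using hu, ⟨h0, hu.trans this⟩, rfl⟩
      rw [this, Real.volume_Icc, sub_zero]
    · intro A _ B _ hAB
      refine Set.disjoint_left.2 fun u hu hu' => hAB ?_
      exact hu.2.symm.trans hu'.2
    · intro S' _
      exact G.measurableSet_nextSet_eq S S'
  calc ∑ S' : Finset V, (S'.card : ℝ≥0∞) * G.espKernel S S'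
      = ∑ S' : Finset V, ∑ y : V, if y ∈ S' then G.espKernel S S' else 0 := by
        refine Finset.sum_congr rfl fun S' _ => ?_
        rw [← Finset.sum_filter]
        simp
    _ = ∑ y : V, ENNReal.ofReal (G.weight {y} S) := by
        rw [Finset.sum_comm]
        refine Finset.sum_congr rfl fun y _ => ?_
        rw [← Finset.sum_filter, h1]
    _ = S.card := by
        rw [← ENNReal.ofReal_sum_of_nonneg fun y _ => G.weight_singleton_nonneg y S,
          sum_weight_singleton, ENNReal.ofReal_natCast]

/-- One step of the volume-biased evolving set process from `S ≠ ∅`: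
the next set is `S'` with probability `(|S'| / |S|) · P(S → S')`. -/
def biasedStep (S : Finset V) : PMF (Finset V) :=
  if h : S.Nonempty then
    PMF.ofFintype (fun S' => (S'.card : ℝ≥0∞) * G.espKernel S S' / (S.card : ℝ≥0∞)) <| by
      simp only [div_eq_mul_inv]
      rw [← Finset.sum_mul, sum_card_mul_espKernel]
      exact ENNReal.mul_inv_cancel (by simpa using h.ne_empty) (by simp)
  else PMF.pure ∅

/-! ### The evolving set algorithm and its running time

A copy of the process keeps `w(y, S)`, for the vertices `y` where it is positive, in balanced search
trees (one for `y ∈ S`, one for `y ∉ S`) ordered by `w(y, S)` and augmented with subtree sizes and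
sums.  The following cost `O(log n)` each, and every one of them is charged `opCost`:
* inserting, deleting or changing the entry of one vertex; so a vertex `x` that enters or leaves the
  current set is charged once for each neighbour, as `w(y, S)` changes for all neighbours `y` of `x`;
* drawing the next set that differs from the current one, together with the (geometrically
  distributed) number of steps until then, finding its size, and computing `φ` and `φ^V` of the
  current set.
-/

/-- The number of neighbours of `x` (`x` itself included if it has a self-loop). -/
def deg (x : V) : ℕ := (Finset.univ.filter fun y => 0 < G.w x y).card

/-- The largest number of neighbours of a vertex. -/
def maxDeg : ℕ := Finset.univ.sup G.deg

/-- Cost of one search tree operation, of order `log n`. -/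
def opCost (_ : RegularGraph V) : ℕ := Nat.log 2 (Fintype.card V) + 1

/-- Cost of moving from `S` to `S'`.  Steps that do not change the set are skipped together. -/
def moveCost (S S' : Finset V) : ℕ :=
  if S' = S then 0 else G.opCost * (1 + ∑ x ∈ symmDiff S S', G.deg x)

/-- One copy, from the current set `S`, for at most `T` further steps.  It returns the first
set with `|S| ≤ K` and `Ψ(S) ≤ θ`, and gives up when the size of the set would exceed `K` (which
is noticed before the new set is written down).  The number is the time used. -/
def runCopy (K θ : ℝ) : ℕ → Finset V → PMF (Option (Finset V) × ℕ)
  | 0, S => if (S.card : ℝ) ≤ K ∧ G.Psi S ≤ θ then PMF.pure (some S, 0) else PMF.pure (none, 0)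
  | T + 1, S =>
    if (S.card : ℝ) ≤ K ∧ G.Psi S ≤ θ then PMF.pure (some S, 0)
    else (G.biasedStep S).bind fun S' =>
      if (S'.card : ℝ) ≤ K then
        (runCopy K θ T S').map fun r => (r.1, G.moveCost S S' + r.2)
      else PMF.pure (none, G.opCost)

/-- At most `N` independent copies, each started from `{v}` and run for at most `T` steps,
until one of them returns a set. The second component is the total time. -/
def runCopies (K θ : ℝ) (T : ℕ) (v : V) : ℕ → PMF (Option (Finset V) × ℕ)
  | 0 => PMF.pure (none, 0)
  | N + 1 => (G.runCopy K θ T {v}).bind fun r =>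
      match r with
      | (some S, t) => PMF.pure (some S, G.opCost * (1 + G.deg v) + t)
      | (none, t) =>
        (runCopies K θ T v N).map fun r' => (r'.1, G.opCost * (1 + G.deg v) + t + r'.2)

/-- The evolving set algorithm with start vertex `v`, for the target size `k`, the target expansion
`φ` and the exponent `ε`; `c` and `C` are its numerical constants.  The result is the joint law
of the returned set (`none` if there is none) and of the running time. -/
def evolvingSetAlgorithm (c C : ℝ) (v : V) (k : ℕ) (φ ε : ℝ) : PMF (Option (Finset V) × ℕ) :=
  G.runCopies (C * (k : ℝ) ^ (1 + ε)) (C * φ / ε) ⌈c * (1 + ε * Real.log k) / φ⌉₊ v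
    ⌈C * (k : ℝ) ^ ε⌉₊

end RegularGraph

end

/-!
Run the volume-biased process `S₀ = {v}, S₁, …` and write `K` for the size limit and `θ` for the
target value of `Ψ`.  By the duality of the evolving set process with the random walk, the average
over `S_t` of the probability that the walk stays in `A` for `T - t` more steps is a
submartingale.  As this average is at most `|A| / K` on sets larger than `K`, the process is likely
to stay below `K` if the walk from `v` is likely to stay in `A`.  On the other hand, as long as
`Ψ > θ`, the expectation of `√(K / |S_t|)` decreases by a factor `1 - θ / 24` per step, because the
unbiased successor `R` of a set `S` satisfies `1 - E √(|R| / |S|) ≥ Ψ(S) / 24`.  Hence a single copy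
fails with probability at most `1 - P(stay in A) + |A| / K + √K exp (-θ T / 24)`.

For at least half of the vertices of `A` the walk stays in `A` for `T` steps with probability at
least `exp (-16 φ(A) T) / 8`, which is of order `|A| ^ (-ε)`: the indicator of any half of `A` has a
constant fraction of its mass on eigenvalues at least `1 - 8 φ(A)` of the walk killed outside `A`,
since the indicator of `A` has most of its mass there.  So `O(|A| ^ ε)` copies suffice.

For the running time, the expected relative change of the set in one step is at most
`2 φ(S) ≤ α + φ(S) ^ 2 / α`.  The last term is at most a multiple of the drift
`Ψ(S) / 12 ≥ φ(S) ^ 2 / 12` of `log |S|` and sums to `O(log n / α)` over a copy; take `α = √φ(A)`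
and apply Markov's inequality.
-/

noncomputable section

section RealInequalities

lemma mul_min_one_le_six_mul_sqrt_one_add_sub_one_sq {x : ℝ} (hx : 0 ≤ x) :
    x * min x 1 ≤ 6 * (√(1 + x) - 1) ^ 2 := by
  have h_sq : √(1 + x) ^ 2 = 1 + x := Real.sq_sqrt (by linarith)
  have h_one : 1 ≤ √(1 + x) := Real.one_le_sqrt.2 (by linarith)
  rcases le_total x 1 with h | h
  · have h_le : √(1 + x) ≤ 1.43 := Real.sqrt_le_iff.2 ⟨by norm_num, by linarith⟩
    have h_le' : (√(1 + x) + 1) ^ 2 ≤ 6 := by nlinarith [h_one]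
    calc x * min x 1 = (√(1 + x) + 1) ^ 2 * (√(1 + x) - 1) ^ 2 := by
          rw [min_eq_left h]; linear_combination (-(√(1 + x) ^ 2) + 1 - x) * h_sq
      _ ≤ 6 * (√(1 + x) - 1) ^ 2 := by gcongr
  · have h_ge : 1.4 ≤ √(1 + x) := Real.le_sqrt_of_sq_le (by norm_num; linarith)
    rw [min_eq_right h]
    nlinarith [h_ge]

lemma exp_neg_two_mul_le_one_sub {x : ℝ} (h0 : 0 ≤ x) (h1 : x ≤ 1 / 2) :
    Real.exp (-(2 * x)) ≤ 1 - x := by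
  have h_half : Real.exp (-1) ≤ 1 / 2 := Real.exp_neg_one_lt_d9.le.trans (by norm_num)
  have h_convex := convexOn_exp.2 (Set.mem_univ 0) (Set.mem_univ (-1))
    (show 0 ≤ 1 - 2 * x by linarith) (show 0 ≤ 2 * x by linarith) (by ring)
  simp only [smul_eq_mul, mul_zero, mul_neg, mul_one, zero_add, Real.exp_zero] at h_convex
  nlinarith

end RealInequalities

lemma card_le_two_mul_card_filter_le {α : Type*} {A : Finset α} {f : α → ℝ} {δ : ℝ}
    (h : ∀ B ⊆ A, A.card ≤ 2 * B.card → δ * B.card ≤ ∑ a ∈ B, f a) :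
    A.card ≤ 2 * (A.filter (δ ≤ f ·)).card := by
  by_contra! h_lt
  have h_card := A.card_filter_add_card_filter_not (δ ≤ f ·)
  have h_sum := h _ (A.filter_subset (¬ δ ≤ f ·)) (by omega)
  refine h_sum.not_gt ?_
  calc ∑ a ∈ A with ¬ δ ≤ f a, f a < ∑ a ∈ A with ¬ δ ≤ f a, δ :=
        Finset.sum_lt_sum_of_nonempty (Finset.card_pos.1 (by omega))
          fun a ha => not_le.1 (Finset.mem_filter.1 ha).2
    _ = δ * (A.filter (¬ δ ≤ f ·)).card := by rw [Finset.sum_const, nsmul_eq_mul, mul_comm]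

section SpectralDecomposition

variable {𝕜 E : Type*} [RCLike 𝕜] [NormedAddCommGroup E] [InnerProductSpace 𝕜 E]

lemma sq_norm_le_eight_mul_sum_sq_norm_inner {ι : Type*} [Fintype ι] [DecidableEq ι]
    (b : OrthonormalBasis ι 𝕜 E) {x z : E}
    (hxz : inner 𝕜 x z = (‖x‖ : 𝕜) ^ 2) (hz : ‖z‖ ^ 2 ≤ 2 * ‖x‖ ^ 2) {H : Finset ι}
    (hH : 8 * ∑ i ∈ Hᶜ, ‖inner 𝕜 (b i) z‖ ^ 2 ≤ ‖z‖ ^ 2) :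
    ‖x‖ ^ 2 ≤ 8 * ∑ i ∈ H, ‖inner 𝕜 (b i) x‖ ^ 2 := by
  have h_cs (J : Finset ι) : (∑ i ∈ J, ‖inner 𝕜 (b i) x‖ * ‖inner 𝕜 (b i) z‖) ^ 2 ≤
      (∑ i ∈ J, ‖inner 𝕜 (b i) x‖ ^ 2) * ∑ i ∈ J, ‖inner 𝕜 (b i) z‖ ^ 2 :=
    Finset.sum_mul_sq_le_sq_mul_sq _ _ _
  have h_le (y : E) (J : Finset ι) : ∑ i ∈ J, ‖inner 𝕜 (b i) y‖ ^ 2 ≤ ‖y‖ ^ 2 :=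
    b.sum_sq_norm_inner_right y ▸ Finset.sum_le_univ_sum_of_nonneg fun i => by positivity
  have h_split : ‖x‖ ^ 2 ≤ ∑ i ∈ H, ‖inner 𝕜 (b i) x‖ * ‖inner 𝕜 (b i) z‖ +
      ∑ i ∈ Hᶜ, ‖inner 𝕜 (b i) x‖ * ‖inner 𝕜 (b i) z‖ := by
    calc ‖x‖ ^ 2 = ‖inner 𝕜 x z‖ := by simp [hxz]
      _ = ‖∑ i, inner 𝕜 x (b i) * inner 𝕜 (b i) z‖ := by rw [b.sum_inner_mul_inner]
      _ ≤ ∑ i, ‖inner 𝕜 x (b i) * inner 𝕜 (b i) z‖ := norm_sum_le _ _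
      _ = _ := by simp only [Finset.sum_add_sum_compl, norm_mul, norm_inner_symm x]
  have h_compl : ∑ i ∈ Hᶜ, ‖inner 𝕜 (b i) x‖ * ‖inner 𝕜 (b i) z‖ ≤ ‖x‖ ^ 2 / 2 := by
    refine abs_le_of_sq_le_sq' ?_ (by positivity) |>.2
    calc _ ≤ _ := h_cs Hᶜ
      _ ≤ ‖x‖ ^ 2 * (‖x‖ ^ 2 / 4) := by gcongr; exacts [h_le x _, by linarith]
      _ = (‖x‖ ^ 2 / 2) ^ 2 := by ring
  rcases eq_or_ne x 0 with rfl | hx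
  · simp
  have hx_pos : 0 < ‖x‖ ^ 2 := by positivity
  have h_main : (‖x‖ ^ 2 / 2) ^ 2 ≤ (∑ i ∈ H, ‖inner 𝕜 (b i) x‖ ^ 2) * (2 * ‖x‖ ^ 2) := by
    calc (‖x‖ ^ 2 / 2) ^ 2 ≤ (∑ i ∈ H, ‖inner 𝕜 (b i) x‖ * ‖inner 𝕜 (b i) z‖) ^ 2 := by
          gcongr; linarith
      _ ≤ _ := h_cs H
      _ ≤ _ := by gcongr; exact (h_le z _).trans hz
  nlinarith

variable [FiniteDimensional 𝕜 E] {T : E →ₗ[𝕜] E}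

lemma inner_eigenvectorBasis_pow_apply (hT : T.IsSymmetric) (t : ℕ) (x : E)
    (i : Fin (Module.finrank 𝕜 E)) :
    inner 𝕜 (hT.eigenvectorBasis rfl i) ((T ^ t) x) =
      (hT.eigenvalues rfl i : 𝕜) ^ t * inner 𝕜 (hT.eigenvectorBasis rfl i) x := by
  induction t with
  | zero => simp
  | succ t ih =>
    rw [pow_succ', Module.End.mul_apply, ← hT, hT.apply_eigenvectorBasis, inner_smul_left, ih,
      RCLike.conj_ofReal, pow_succ', mul_assoc]

lemma re_inner_pow_apply_eq_sum (hT : T.IsSymmetric) (t : ℕ) (x : E) :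
    RCLike.re (inner 𝕜 x ((T ^ t) x)) =
      ∑ i, hT.eigenvalues rfl i ^ t * ‖inner 𝕜 (hT.eigenvectorBasis rfl i) x‖ ^ 2 := by
  rw [← (hT.eigenvectorBasis rfl).sum_inner_mul_inner, map_sum]
  refine Finset.sum_congr rfl fun i _ => ?_
  rw [inner_eigenvectorBasis_pow_apply, mul_left_comm, ← RCLike.ofReal_pow, RCLike.re_ofReal_mul,
    inner_mul_symm_re_eq_norm, norm_mul, norm_inner_symm x, sq]

lemma eigenvalues_le_one (hT : T.IsSymmetric) (h1 : (1 - T).IsPositive)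
    (i : Fin (Module.finrank 𝕜 E)) : hT.eigenvalues rfl i ≤ 1 := by
  have h := h1.re_inner_nonneg_right (hT.eigenvectorBasis rfl i)
  simpa [inner_sub_right, inner_smul_right] using h

lemma mul_sum_sq_norm_inner_lt_le (hT : T.IsSymmetric) (h1 : (1 - T).IsPositive) (δ : ℝ) (z : E) :
    δ * ∑ i with hT.eigenvalues rfl i < 1 - δ, ‖inner 𝕜 (hT.eigenvectorBasis rfl i) z‖ ^ 2 ≤
      ‖z‖ ^ 2 - RCLike.re (inner 𝕜 z (T z)) := by
  have h_re := re_inner_pow_apply_eq_sum hT 1 z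
  simp only [pow_one] at h_re
  rw [h_re, ← (hT.eigenvectorBasis rfl).sum_sq_norm_inner_right z, ← Finset.sum_sub_distrib,
    Finset.mul_sum]
  calc _ ≤ ∑ i with hT.eigenvalues rfl i < 1 - δ,
        (‖inner 𝕜 (hT.eigenvectorBasis rfl i) z‖ ^ 2 -
          hT.eigenvalues rfl i * ‖inner 𝕜 (hT.eigenvectorBasis rfl i) z‖ ^ 2) := by
        refine Finset.sum_le_sum fun i hi => ?_
        rw [← one_sub_mul]
        gcongr
        linarith [(Finset.mem_filter.1 hi).2]
    _ ≤ _ := Finset.sum_le_univ_sum_of_nonneg fun i => by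
        rw [← one_sub_mul]
        exact mul_nonneg (sub_nonneg.2 (eigenvalues_le_one hT h1 i)) (sq_nonneg _)

lemma one_sub_pow_mul_sq_norm_le_eight_mul_re_inner_pow (h0 : T.IsPositive)
    (h1 : (1 - T).IsPositive) {δ : ℝ} (hδ0 : 0 < δ) (hδ1 : δ ≤ 1) {x z : E}
    (hxz : inner 𝕜 x z = (‖x‖ : 𝕜) ^ 2) (hz : ‖z‖ ^ 2 ≤ 2 * ‖x‖ ^ 2)
    (hTz : 8 * (‖z‖ ^ 2 - RCLike.re (inner 𝕜 z (T z))) ≤ δ * ‖z‖ ^ 2) (t : ℕ) :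
    (1 - δ) ^ t * ‖x‖ ^ 2 ≤ 8 * RCLike.re (inner 𝕜 x ((T ^ t) x)) := by
  have hT := h0.isSymmetric
  set H := Finset.univ.filter fun i => 1 - δ ≤ hT.eigenvalues rfl i
  have h_mass : 8 * ∑ i ∈ Hᶜ, ‖inner 𝕜 (hT.eigenvectorBasis rfl i) z‖ ^ 2 ≤ ‖z‖ ^ 2 := by
    simp only [H, Finset.compl_filter, not_le]
    nlinarith [mul_sum_sq_norm_inner_lt_le hT h1 δ z]
  rw [re_inner_pow_apply_eq_sum hT]
  calc (1 - δ) ^ t * ‖x‖ ^ 2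
      ≤ (1 - δ) ^ t * (8 * ∑ i ∈ H, ‖inner 𝕜 (hT.eigenvectorBasis rfl i) x‖ ^ 2) := by
        have := pow_nonneg (sub_nonneg.2 hδ1) t
        gcongr
        exact sq_norm_le_eight_mul_sum_sq_norm_inner _ hxz hz h_mass
    _ = 8 * ∑ i ∈ H, (1 - δ) ^ t * ‖inner 𝕜 (hT.eigenvectorBasis rfl i) x‖ ^ 2 := by
        rw [← Finset.mul_sum]; ring
    _ ≤ 8 * ∑ i ∈ H, hT.eigenvalues rfl i ^ t *
          ‖inner 𝕜 (hT.eigenvectorBasis rfl i) x‖ ^ 2 := by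
        have := sub_nonneg.2 hδ1
        gcongr with i hi
        exact (Finset.mem_filter.1 hi).2
    _ ≤ _ := mul_le_mul_of_nonneg_left (Finset.sum_le_univ_sum_of_nonneg fun i =>
        mul_nonneg (pow_nonneg (h0.nonneg_eigenvalues rfl i) t) (sq_nonneg _)) (by norm_num)

end SpectralDecomposition
section PmfMean

variable {α β : Type*}

/-- The expectation of an `ℝ≥0∞`-valued function under a probability mass function. -/
def pmfMean (p : PMF α) (g : α → ℝ≥0∞) : ℝ≥0∞ := ∑' a, p a * g a

lemma pmfMean_bind (p : PMF α) (f : α → PMF β) (g : β → ℝ≥0∞) :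
    pmfMean (p.bind f) g = pmfMean p fun a => pmfMean (f a) g := by
  simp only [pmfMean, PMF.bind_apply, ← ENNReal.tsum_mul_right, ← ENNReal.tsum_mul_left, mul_assoc]
  exact ENNReal.tsum_comm

lemma pmfMean_pure (a : α) (g : α → ℝ≥0∞) : pmfMean (PMF.pure a) g = g a := by
  rw [pmfMean, tsum_eq_single a fun b hb => by simp [hb]]
  simp

lemma pmfMean_map (p : PMF α) (f : α → β) (g : β → ℝ≥0∞) :
    pmfMean (p.map f) g = pmfMean p (g ∘ f) := by
  simp only [← PMF.bind_pure_comp, pmfMean_bind, Function.comp_def, pmfMean_pure]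

lemma pmfMean_const (p : PMF α) (c : ℝ≥0∞) : pmfMean p (fun _ => c) = c := by
  rw [pmfMean, ENNReal.tsum_mul_right, p.tsum_coe, one_mul]

lemma pmfMean_add (p : PMF α) (g h : α → ℝ≥0∞) :
    pmfMean p (fun a => g a + h a) = pmfMean p g + pmfMean p h := by
  simp only [pmfMean, mul_add, ENNReal.tsum_add]

lemma pmfMean_mono (p : PMF α) {g h : α → ℝ≥0∞} (hgh : ∀ a, g a ≤ h a) :
    pmfMean p g ≤ pmfMean p h :=
  ENNReal.tsum_le_tsum fun a => mul_le_mul_right (hgh a) _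

lemma mul_toOuterMeasure_le_pmfMean (p : PMF α) {g : α → ℝ≥0∞} {b : ℝ≥0∞} {s : Set α}
    (hs : ∀ a ∈ s, b ≤ g a) : b * p.toOuterMeasure s ≤ pmfMean p g := by
  rw [PMF.toOuterMeasure_apply, pmfMean, ← ENNReal.tsum_mul_left]
  refine ENNReal.tsum_le_tsum fun a => ?_
  by_cases ha : a ∈ s
  · rw [Set.indicator_of_mem ha, mul_comm]
    exact mul_le_mul_right (hs a ha) _
  · simp [ha]

end PmfMean

lemma ofReal_one_sub_pow_le_half {ρ : ℝ} {N : ℕ} (h : 1 ≤ N * ρ) :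
    ENNReal.ofReal (1 - ρ) ^ N ≤ ENNReal.ofReal (1 / 2) := by
  calc ENNReal.ofReal (1 - ρ) ^ N ≤ ENNReal.ofReal (Real.exp (-ρ)) ^ N := by
        gcongr
        exact Real.one_sub_le_exp_neg ρ
    _ = ENNReal.ofReal (Real.exp (-(N * ρ))) := by
        rw [← ENNReal.ofReal_pow (Real.exp_pos _).le, ← Real.exp_nat_mul, mul_neg]
    _ ≤ ENNReal.ofReal (Real.exp (-1)) := by gcongr
    _ ≤ ENNReal.ofReal (1 / 2) :=
        ENNReal.ofReal_le_ofReal (Real.exp_neg_one_lt_d9.le.trans (by norm_num))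

lemma toOuterMeasure_lt_le_ofReal_inv {α : Type*} (p : PMF α) {X : α → ℝ} {m c : ℝ} (hm : 0 < m)
    (hc : 0 < c) (hX : pmfMean p (fun a => ENNReal.ofReal (X a)) ≤ ENNReal.ofReal m) :
    p.toOuterMeasure {a | c * m < X a} ≤ ENNReal.ofReal c⁻¹ := by
  have h_markov : ENNReal.ofReal (c * m) * p.toOuterMeasure {a | c * m < X a} ≤
      ENNReal.ofReal (c * m) * ENNReal.ofReal c⁻¹ := by
    calc _ ≤ pmfMean p fun a => ENNReal.ofReal (X a) :=
          mul_toOuterMeasure_le_pmfMean p fun a ha => ENNReal.ofReal_le_ofReal (le_of_lt ha)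
      _ ≤ ENNReal.ofReal m := hX
      _ = _ := by rw [← ENNReal.ofReal_mul (by positivity), mul_right_comm, mul_inv_cancel₀ hc.ne',
          one_mul]
  exact (ENNReal.mul_le_mul_iff_right (ENNReal.ofReal_pos.2 (by positivity)).ne'
    ENNReal.ofReal_ne_top).1 h_markov

lemma ofReal_one_sub_sub_le_toOuterMeasure {α : Type*} (p : PMF α) {E F₁ F₂ : Set α} {a b : ℝ}
    (ha : 0 ≤ a) (hb : 0 ≤ b) (h_support : p.support ⊆ E ∪ (F₁ ∪ F₂))
    (h₁ : p.toOuterMeasure F₁ ≤ ENNReal.ofReal a) (h₂ : p.toOuterMeasure F₂ ≤ ENNReal.ofReal b) :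
    ENNReal.ofReal (1 - (a + b)) ≤ p.toOuterMeasure E := by
  rw [ENNReal.ofReal_sub _ (add_nonneg ha hb), ENNReal.ofReal_one, ENNReal.ofReal_add ha hb,
    tsub_le_iff_right]
  calc 1 = p.toOuterMeasure (E ∪ (F₁ ∪ F₂)) :=
        ((p.toOuterMeasure_apply_eq_one_iff _).2 h_support).symm
    _ ≤ p.toOuterMeasure E + (p.toOuterMeasure F₁ + p.toOuterMeasure F₂) :=
        (measure_union_le _ _).trans (by gcongr; exact measure_union_le _ _)
    _ ≤ _ := by gcongr

lemma sqrt_mul_rpow_mul_exp_le {a k ε ε₀ : ℝ} (C : ℝ) (hk : 1 ≤ k) (hε : 0 < ε) (hεε₀ : ε ≤ ε₀)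
    (ha : (1 + 3 * ε₀) / 2 ≤ a) :
    √(C * k ^ (1 + ε)) * Real.exp (-(a * (1 / ε + Real.log k))) ≤
      √C * Real.exp (-(a / ε₀)) * k ^ (-ε) := by
  have hk0 : 0 < k := by linarith
  have h_sqrt : √(C * k ^ (1 + ε)) = √C * Real.exp (Real.log k * ((1 + ε) / 2)) := by
    rw [Real.sqrt_mul' C (by positivity), Real.sqrt_eq_rpow (k ^ (1 + ε)),
      ← Real.rpow_mul hk0.le, Real.rpow_def_of_pos hk0]
    ring_nf
  calc √(C * k ^ (1 + ε)) * Real.exp (-(a * (1 / ε + Real.log k)))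
      = √C * Real.exp (-(a / ε)) * Real.exp (Real.log k * ((1 + ε) / 2 - a)) := by
        rw [h_sqrt, mul_assoc, mul_assoc, ← Real.exp_add, ← Real.exp_add]
        ring_nf
    _ ≤ √C * Real.exp (-(a / ε₀)) * Real.exp (Real.log k * -ε) := by
        gcongr
        · linarith
        · exact Real.log_nonneg hk
        · linarith
    _ = √C * Real.exp (-(a / ε₀)) * k ^ (-ε) := by rw [Real.rpow_def_of_pos hk0]

lemma exists_forall_div_add_sqrt_mul_exp_le {ε₀ p₀ b : ℝ} (hε₀ : 0 < ε₀) (hp₀ : 0 < p₀)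
    (hb : 0 < b) :
    ∃ C : ℝ, 1 ≤ C ∧ 1 ≤ C * p₀ ∧ ∀ k ε : ℝ, 1 ≤ k → 0 < ε → ε ≤ ε₀ →
      k / (C * k ^ (1 + ε)) + √(C * k ^ (1 + ε)) * Real.exp (-(b * C * (1 / ε + Real.log k))) ≤
        p₀ * k ^ (-ε) := by
  have h_lim : Filter.Tendsto (fun C : ℝ => C * Real.exp (-(b / ε₀ * C))) Filter.atTop (nhds 0) :=
    by simpa using tendsto_rpow_mul_exp_neg_mul_atTop_nhds_zero 1 (b / ε₀) (by positivity)
  obtain ⟨C, hC1, hCp, hCb, hC_exp⟩ := ((Filter.eventually_ge_atTop 1).and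
    ((Filter.eventually_ge_atTop (2 / p₀)).and
      ((Filter.eventually_ge_atTop ((1 + 3 * ε₀) / 2 / b)).and
        (h_lim.eventually_le_const (half_pos hp₀))))).exists
  rw [div_le_iff₀ hp₀] at hCp
  rw [div_le_iff₀' hb] at hCb
  refine ⟨C, hC1, by linarith, fun k ε hk hε hεε₀ => ?_⟩
  have hk0 : 0 < k := by linarith
  have h_div : k / (C * k ^ (1 + ε)) ≤ p₀ / 2 * k ^ (-ε) := by
    rw [Real.rpow_add hk0, Real.rpow_one, Real.rpow_neg hk0.le, div_le_iff₀ (by positivity)]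
    field_simp
    linarith
  have h_sqrt : √C * Real.exp (-(b * C / ε₀)) ≤ p₀ / 2 := by
    calc √C * Real.exp (-(b * C / ε₀)) ≤ C * Real.exp (-(b / ε₀ * C)) := by
          rw [mul_div_right_comm]
          gcongr
          exact Real.sqrt_le_iff.2 ⟨by linarith, by nlinarith⟩
      _ ≤ p₀ / 2 := hC_exp
  have h_error := sqrt_mul_rpow_mul_exp_le C hk hε hεε₀ hCb
  have := mul_le_mul_of_nonneg_right h_sqrt (Real.rpow_nonneg hk0.le (-ε))
  linarith

namespace RegularGraph

section Weights

variable {V : Type*} [Fintype V] (G : RegularGraph V)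

lemma weight_nonneg (S T : Finset V) : 0 ≤ G.weight S T :=
  Finset.sum_nonneg fun i _ => Finset.sum_nonneg fun j _ => G.nonneg i j

lemma weight_singleton (y : V) (S : Finset V) : G.weight {y} S = ∑ x ∈ S, G.w x y := by
  simp only [weight, Finset.sum_singleton, G.symm y]

lemma sum_weight_singleton_mul (S : Finset V) (f : V → ℝ) :
    ∑ y, G.weight {y} S * f y = ∑ x ∈ S, ∑ y, G.w x y * f y := by
  simp only [weight_singleton, Finset.sum_mul]
  exact Finset.sum_comm

lemma sum_weight_singleton_of_finset (S T : Finset V) :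
    ∑ y ∈ T, G.weight {y} S = G.weight S T := by
  simp only [weight_singleton]
  exact Finset.sum_comm

lemma weight_self_add_weight_compl [DecidableEq V] (S : Finset V) :
    G.weight S S + G.weight S Sᶜ = S.card := by
  simp only [weight, ← Finset.sum_add_distrib, Finset.sum_add_sum_compl, G.degree_eq_one,
    Finset.sum_const, nsmul_one]

variable {G}

lemma IsLazy.half_le_weight_singleton (hG : G.IsLazy) {S : Finset V} {y : V} (hy : y ∈ S) :
    1 / 2 ≤ G.weight {y} S := by
  rw [weight_singleton]
  exact (hG y).trans (Finset.single_le_sum (f := (G.w · y)) (fun x _ => G.nonneg x y) hy)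

lemma IsLazy.weight_singleton_le_half (hG : G.IsLazy) {S : Finset V} {y : V} (hy : y ∉ S) :
    G.weight {y} S ≤ 1 / 2 := by
  have h_sum : ∑ x ∈ S.cons y hy, G.w y x ≤ 1 :=
    G.degree_eq_one y ▸ Finset.sum_le_univ_sum_of_nonneg fun x => G.nonneg y x
  rw [Finset.sum_cons] at h_sum
  simp only [weight, Finset.sum_singleton]
  linarith [hG y]

end Weights

section EvolvingSets

variable {V : Type*} [Fintype V] (G : RegularGraph V)

/-- The transition probability of the evolving set process as a real number. -/
def espProb (S S' : Finset V) : ℝ := (G.espKernel S S').toReal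

lemma espProb_nonneg (S S' : Finset V) : 0 ≤ G.espProb S S' := ENNReal.toReal_nonneg

lemma espKernel_ne_top (S S' : Finset V) : G.espKernel S S' ≠ ∞ :=
  measure_ne_top_of_subset (fun _ hu => hu.1) measure_Icc_lt_top.ne

lemma exists_eq_nextSet {S S' : Finset V} (h : G.espProb S S' ≠ 0) : ∃ u, G.nextSet S u = S' := by
  obtain ⟨u, hu⟩ := nonempty_of_measure_ne_zero (ENNReal.toReal_ne_zero.1 h).1
  exact ⟨u, hu.2⟩

lemma nextSet_anti (S : Finset V) : Antitone (G.nextSet S) := fun _ _ h =>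
  Finset.monotone_filter_right _ fun _ _ hy => h.trans hy

lemma sum_espProb_filter (S : Finset V) (q : Finset V → Prop) [DecidablePred q] :
    ∑ S' with q S', G.espProb S S' =
      volume.real {u : ℝ | u ∈ Set.Icc (0 : ℝ) 1 ∧ q (G.nextSet S u)} := by
  have h_union : {u : ℝ | u ∈ Set.Icc (0 : ℝ) 1 ∧ q (G.nextSet S u)} =
      ⋃ S' ∈ Finset.univ.filter q, {u : ℝ | u ∈ Set.Icc (0 : ℝ) 1 ∧ G.nextSet S u = S'} := by
    ext u
    simp only [Set.mem_ofPred_eq, Finset.mem_filter_univ, Set.mem_iUnion, exists_prop]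
    exact ⟨fun h => ⟨_, h.2, h.1, rfl⟩, fun ⟨_, hq, hu, h⟩ => ⟨hu, h ▸ hq⟩⟩
  classical
  rw [h_union, measureReal_biUnion_finset _ (fun S' _ => G.measurableSet_nextSet_eq S S')
    fun S' _ => G.espKernel_ne_top S S']
  · rfl
  · exact fun A _ B _ hAB => Set.disjoint_left.2 fun u hu hu' => hAB (hu.2.symm.trans hu'.2)

lemma sum_espProb (S : Finset V) : ∑ S', G.espProb S S' = 1 := by
  have h := G.sum_espProb_filter S (fun _ => True)
  simp only [Finset.filter_true, and_true] at h
  rw [h]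
  exact (Real.volume_real_Icc_of_le zero_le_one).trans (sub_zero 1)

lemma sum_espProb_mem [DecidableEq V] (S : Finset V) (y : V) :
    ∑ S' with y ∈ S', G.espProb S S' = G.weight {y} S := by
  have h_Icc : {u : ℝ | u ∈ Set.Icc (0 : ℝ) 1 ∧ y ∈ G.nextSet S u} =
      Set.Icc 0 (G.weight {y} S) := by
    ext u
    simp only [nextSet, Finset.mem_filter_univ, Set.mem_Icc, Set.mem_ofPred_eq]
    exact ⟨fun h => ⟨h.1.1, h.2⟩,
      fun h => ⟨⟨h.1, h.2.trans (G.weight_singleton_le_one y S)⟩, h.2⟩⟩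
  rw [sum_espProb_filter, h_Icc, Real.volume_real_Icc_of_le (G.weight_singleton_nonneg y S),
    sub_zero]

lemma sum_espProb_mul_sum (S : Finset V) (f : V → ℝ) :
    ∑ S', G.espProb S S' * ∑ y ∈ S', f y = ∑ x ∈ S, ∑ y, G.w x y * f y := by
  classical
  calc ∑ S', G.espProb S S' * ∑ y ∈ S', f y
      = ∑ S', ∑ y, if y ∈ S' then G.espProb S S' * f y else 0 := by
        simp only [Finset.mul_sum, Finset.sum_ite_mem, Finset.univ_inter]
    _ = ∑ y, G.weight {y} S * f y := by
        rw [Finset.sum_comm]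
        simp only [← Finset.sum_filter, ← Finset.sum_mul, sum_espProb_mem]
    _ = _ := G.sum_weight_singleton_mul S f

lemma sum_espProb_mul_card_inter [DecidableEq V] (S T : Finset V) :
    ∑ S', G.espProb S S' * ((S' ∩ T).card : ℝ) = G.weight S T := by
  simpa [weight] using G.sum_espProb_mul_sum S (fun y => if y ∈ T then 1 else 0)

lemma sum_espProb_mul_card (S : Finset V) :
    ∑ S', G.espProb S S' * (S'.card : ℝ) = S.card := by
  simpa [G.degree_eq_one] using G.sum_espProb_mul_sum S 1

lemma sum_espProb_mul_sqrt {S : Finset V} (hS : S.Nonempty) :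
    ∑ S', G.espProb S S' * √((S'.card : ℝ) / S.card) =
      1 - (∑ S', G.espProb S S' * (√((S'.card : ℝ) / S.card) - 1) ^ 2) / 2 := by
  have hS0 : (S.card : ℝ) ≠ 0 := by exact_mod_cast hS.card_ne_zero
  have h_sq (S' : Finset V) : (√((S'.card : ℝ) / S.card) - 1) ^ 2 =
      S'.card * (S.card : ℝ)⁻¹ + 1 - 2 * √((S'.card : ℝ) / S.card) := by
    rw [sub_sq, Real.sq_sqrt (by positivity)]
    ring
  simp only [h_sq, mul_sub, mul_add, Finset.sum_sub_distrib, Finset.sum_add_distrib, mul_one,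
    ← mul_assoc, ← Finset.sum_mul, mul_comm _ (2 : ℝ), sum_espProb_mul_card, sum_espProb]
  simp only [mul_assoc, ← Finset.mul_sum]
  rw [mul_inv_cancel₀ hS0]
  ring

lemma sum_espProb_mul_card_symmDiff [DecidableEq V] (S : Finset V) :
    ∑ S', G.espProb S S' * ((symmDiff S S').card : ℝ) = 2 * G.weight S Sᶜ := by
  have h_card (S' : Finset V) : ((symmDiff S S').card : ℝ) =
      S.card - (S' ∩ S).card + (S' ∩ Sᶜ).card := by
    have h_left := Finset.card_sdiff_add_card_inter S S'
    rw [symmDiff_def, Finset.sup_eq_union, Finset.card_union_of_disjoint disjoint_sdiff_sdiff,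
      ← h_left, Finset.inter_comm S' S, Finset.sdiff_eq_inter_compl S' S]
    push_cast
    ring
  simp only [h_card, mul_add, mul_sub, Finset.sum_add_distrib, Finset.sum_sub_distrib,
    ← Finset.sum_mul, sum_espProb, sum_espProb_mul_card_inter]
  linarith [G.weight_self_add_weight_compl S]

variable {G}

lemma IsLazy.subset_or_subset (hG : G.IsLazy) {S S' : Finset V} (h : G.espProb S S' ≠ 0) :
    S ⊆ S' ∨ S' ⊆ S := by
  obtain ⟨u, rfl⟩ := G.exists_eq_nextSet h
  simp only [Finset.subset_iff, nextSet, Finset.mem_filter_univ]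
  rcases le_or_gt u (1 / 2) with hu | hu
  · exact .inl fun y hy => hu.trans (hG.half_le_weight_singleton hy)
  · refine .inr fun y hy => ?_
    by_contra hyS
    exact (hu.trans_le hy).not_ge (hG.weight_singleton_le_half hyS)

end EvolvingSets

section GrowthGauge

variable {V : Type*} [Fintype V] [DecidableEq V] (G : RegularGraph V)

lemma halfBoundary_le {S M : Finset V} (hM : M ⊆ Sᶜ) (h : G.weight S Sᶜ / 2 ≤ G.weight S M) :
    G.halfBoundary S ≤ M.card :=
  Nat.sInf_le ⟨M, hM, rfl, h⟩

lemma exists_card_eq_halfBoundary (S : Finset V) :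
    ∃ M ⊆ Sᶜ, M.card = G.halfBoundary S ∧ G.weight S Sᶜ / 2 ≤ G.weight S M :=
  Nat.sInf_mem (s := {m : ℕ | ∃ M ⊆ Sᶜ, M.card = m ∧ G.weight S Sᶜ / 2 ≤ G.weight S M})
    ⟨_, Sᶜ, subset_rfl, rfl, half_le_self (G.weight_nonneg S Sᶜ)⟩

-- The possible next sets form a chain, so the small additions all lie in the largest of them.
lemma exists_small_additions_subset (S : Finset V) :
    ∃ M ⊆ Sᶜ, G.weight S M ≤ G.weight S Sᶜ / 2 ∧ ∀ S', G.espProb S S' ≠ 0 →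
      (S' \ S).card < G.halfBoundary S → S' \ S ⊆ M := by
  set F := Finset.univ.filter fun S' => G.espProb S S' ≠ 0 ∧ (S' \ S).card < G.halfBoundary S
  have h_mem (S' : Finset V) : S' ∈ F ↔ G.espProb S S' ≠ 0 ∧ (S' \ S).card < G.halfBoundary S :=
    Finset.mem_filter_univ _
  rcases F.eq_empty_or_nonempty with hF | hF
  · refine ⟨∅, Finset.empty_subset _, ?_, fun S' h0 h => ?_⟩
    · simpa [weight] using div_nonneg (G.weight_nonneg S Sᶜ) zero_le_two
    · exact absurd ((h_mem S').2 ⟨h0, h⟩) (hF ▸ Finset.notMem_empty S')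
  obtain ⟨M, hMF, h_max⟩ := F.exists_max_image Finset.card hF
  obtain ⟨hM0, hM⟩ := (h_mem M).1 hMF
  have h_sub : M \ S ⊆ Sᶜ := fun y hy => Finset.mem_compl.2 (Finset.mem_sdiff.1 hy).2
  refine ⟨M \ S, h_sub, ?_, fun S' h0 h => Finset.sdiff_subset_sdiff ?_ subset_rfl⟩
  · by_contra! h
    exact hM.not_ge (G.halfBoundary_le h_sub h.le)
  · have h_card := h_max S' ((h_mem S').2 ⟨h0, h⟩)
    obtain ⟨u, rfl⟩ := G.exists_eq_nextSet h0
    obtain ⟨u', rfl⟩ := G.exists_eq_nextSet hM0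
    rcases le_total u' u with hu | hu
    · exact G.nextSet_anti S hu
    · exact (Finset.eq_of_subset_of_card_le (G.nextSet_anti S hu) h_card).superset

lemma half_weight_le_sum_espProb_mul_card_sdiff (S : Finset V) :
    G.weight S Sᶜ / 2 ≤ ∑ S' with G.halfBoundary S ≤ (S' \ S).card,
      G.espProb S S' * ((S' \ S).card : ℝ) := by
  obtain ⟨M, -, hM, h_sub⟩ := G.exists_small_additions_subset S
  have h_total : ∑ S', G.espProb S S' * ((S' \ S).card : ℝ) = G.weight S Sᶜ := by
    simp only [Finset.sdiff_eq_inter_compl, sum_espProb_mul_card_inter]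
  have h_small : ∑ S' with ¬ G.halfBoundary S ≤ (S' \ S).card,
      G.espProb S S' * ((S' \ S).card : ℝ) ≤ G.weight S M := by
    rw [← sum_espProb_mul_card_inter]
    refine (Finset.sum_le_sum fun S' hS' => ?_).trans (Finset.sum_le_univ_sum_of_nonneg fun S' =>
      mul_nonneg (G.espProb_nonneg S S') (Nat.cast_nonneg _))
    rcases eq_or_ne (G.espProb S S') 0 with h0 | h0
    · simp only [h0, zero_mul, le_refl]
    · have h_lt := not_le.1 (Finset.mem_filter.1 hS').2
      have := G.espProb_nonneg S S'
      gcongr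
      exact Finset.subset_inter Finset.sdiff_subset (h_sub S' h0 h_lt)
  linarith [Finset.sum_filter_add_sum_filter_not Finset.univ
    (fun S' => G.halfBoundary S ≤ (S' \ S).card) fun S' => G.espProb S S' * ((S' \ S).card : ℝ)]

lemma expansion_nonneg (S : Finset V) : 0 ≤ G.expansion S :=
  div_nonneg (G.weight_nonneg _ _) (Nat.cast_nonneg _)

lemma vertexExpansion_nonneg (S : Finset V) : 0 ≤ G.vertexExpansion S :=
  le_min (by positivity) zero_le_one

lemma vertexExpansion_mul_le_six_mul_sqrt_sub_one_sq {S S' : Finset V} (hS : S.Nonempty)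
    (h_sub : S ⊆ S') (h : G.halfBoundary S ≤ (S' \ S).card) :
    ((S' \ S).card : ℝ) / S.card * G.vertexExpansion S ≤
      6 * (√((S'.card : ℝ) / S.card) - 1) ^ 2 := by
  have hS0 : (S.card : ℝ) ≠ 0 := by exact_mod_cast hS.card_ne_zero
  have h_ratio : (S'.card : ℝ) / S.card = 1 + ((S' \ S).card : ℝ) / S.card := by
    rw [Finset.cast_card_sdiff h_sub, sub_div, div_self hS0]
    ring
  rw [h_ratio]
  refine le_trans ?_ (mul_min_one_le_six_mul_sqrt_one_add_sub_one_sq (by positivity))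
  unfold vertexExpansion
  gcongr

variable {G}

lemma IsLazy.Psi_le_twelve_mul_sum_espProb (hG : G.IsLazy) {S : Finset V} (hS : S.Nonempty) :
    G.Psi S ≤ 12 * ∑ S', G.espProb S S' * (√((S'.card : ℝ) / S.card) - 1) ^ 2 := by
  have h_nonneg := G.vertexExpansion_nonneg S
  calc G.Psi S = 2 * (G.weight S Sᶜ / 2) * (G.vertexExpansion S / S.card) := by
        unfold Psi expansion; ring
    _ ≤ 2 * (∑ S' with G.halfBoundary S ≤ (S' \ S).card,
          G.espProb S S' * ((S' \ S).card : ℝ)) * (G.vertexExpansion S / S.card) := by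
        gcongr
        exact G.half_weight_le_sum_espProb_mul_card_sdiff S
    _ = 2 * ∑ S' with G.halfBoundary S ≤ (S' \ S).card,
          G.espProb S S' * (((S' \ S).card : ℝ) / S.card * G.vertexExpansion S) := by
        rw [mul_assoc, Finset.sum_mul]
        exact congrArg (2 * ·) (Finset.sum_congr rfl fun S' _ => by ring)
    _ ≤ 2 * ∑ S' with G.halfBoundary S ≤ (S' \ S).card,
          G.espProb S S' * (6 * (√((S'.card : ℝ) / S.card) - 1) ^ 2) := by
        gcongr 2 * ?_
        refine Finset.sum_le_sum fun S' hS' => ?_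
        rcases eq_or_ne (G.espProb S S') 0 with h0 | h0
        · simp only [h0, zero_mul, le_refl]
        refine mul_le_mul_of_nonneg_left ?_ (G.espProb_nonneg S S')
        rcases hG.subset_or_subset h0 with h_sub | h_sub
        · exact G.vertexExpansion_mul_le_six_mul_sqrt_sub_one_sq hS h_sub
            ((Finset.mem_filter_univ S').1 hS')
        · rw [Finset.sdiff_eq_empty_iff_subset.2 h_sub]
          simp only [Finset.card_empty, Nat.cast_zero, zero_div, zero_mul]
          positivity
    _ ≤ 2 * ∑ S', G.espProb S S' * (6 * (√((S'.card : ℝ) / S.card) - 1) ^ 2) := by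
        refine mul_le_mul_of_nonneg_left (Finset.sum_le_univ_sum_of_nonneg fun S' => ?_) zero_le_two
        have := G.espProb_nonneg S S'
        positivity
    _ = _ := by
        rw [Finset.mul_sum, Finset.mul_sum]
        exact Finset.sum_congr rfl fun S' _ => by ring

lemma IsLazy.sum_espProb_mul_sqrt_le (hG : G.IsLazy) {S : Finset V} (hS : S.Nonempty) :
    ∑ S', G.espProb S S' * √((S'.card : ℝ) / S.card) ≤ 1 - G.Psi S / 24 := by
  rw [sum_espProb_mul_sqrt G hS]
  linarith [hG.Psi_le_twelve_mul_sum_espProb hS]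

lemma IsLazy.expansion_le_half (hG : G.IsLazy) (S : Finset V) : G.expansion S ≤ 1 / 2 := by
  have h_self : S.card * (1 / 2 : ℝ) ≤ G.weight S S := by
    rw [← sum_weight_singleton_of_finset, ← nsmul_eq_mul]
    exact Finset.card_nsmul_le_sum _ _ _ fun y hy => hG.half_le_weight_singleton hy
  refine div_le_of_le_mul₀ (Nat.cast_nonneg _) (by norm_num) ?_
  linarith [G.weight_self_add_weight_compl S]

lemma IsLazy.sq_expansion_le_Psi (hG : G.IsLazy) (S : Finset V) :
    G.expansion S ^ 2 ≤ G.Psi S := by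
  obtain ⟨M, hMS, hM, hw⟩ := G.exists_card_eq_halfBoundary S
  have h_weight : G.weight S M ≤ M.card * (1 / 2 : ℝ) := by
    rw [← sum_weight_singleton_of_finset, ← nsmul_eq_mul]
    exact Finset.sum_le_card_nsmul _ _ _ fun y hy =>
      hG.weight_singleton_le_half (Finset.mem_compl.1 (hMS hy))
  rw [sq, Psi]
  refine mul_le_mul_of_nonneg_left (le_min ?_ ?_) (G.expansion_nonneg S)
  · rw [expansion, ← hM]
    gcongr
    linarith
  · linarith [hG.expansion_le_half S]

end GrowthGauge

section BiasedSteps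

variable {V : Type*} [Fintype V] (G : RegularGraph V)

/-- The transition probability of the volume-biased process from a nonempty set as a real number. -/
def biasedProb (S S' : Finset V) : ℝ := G.espProb S S' * S'.card / S.card

lemma biasedProb_nonneg (S S' : Finset V) : 0 ≤ G.biasedProb S S' :=
  div_nonneg (mul_nonneg (G.espProb_nonneg _ _) (Nat.cast_nonneg _)) (Nat.cast_nonneg _)

lemma sum_biasedProb {S : Finset V} (hS : S.Nonempty) : ∑ S', G.biasedProb S S' = 1 := by
  simp only [biasedProb, ← Finset.sum_div, sum_espProb_mul_card]
  exact div_self (by exact_mod_cast hS.card_ne_zero)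

lemma sum_biasedProb_mul (S : Finset V) (f : Finset V → ℝ) :
    ∑ S', G.biasedProb S S' * f S' = (∑ S', G.espProb S S' * (S'.card * f S')) / S.card := by
  rw [Finset.sum_div]
  exact Finset.sum_congr rfl fun S' _ => by rw [biasedProb]; ring

lemma sum_biasedProb_mul_average (S : Finset V) (f : V → ℝ) :
    ∑ S', G.biasedProb S S' * ((∑ y ∈ S', f y) / S'.card) =
      (∑ x ∈ S, ∑ y, G.w x y * f y) / S.card := by
  rw [sum_biasedProb_mul, ← sum_espProb_mul_sum]
  congr! 3 with S'
  rcases S'.eq_empty_or_nonempty with rfl | hS'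
  · simp
  · rw [mul_div_cancel₀ _ (by exact_mod_cast hS'.card_ne_zero)]

lemma sum_biasedProb_mul_card_symmDiff_div_card_le [DecidableEq V] (S : Finset V) :
    ∑ S', G.biasedProb S S' * ((symmDiff S S').card / S'.card : ℝ) ≤ 2 * G.expansion S := by
  rw [sum_biasedProb_mul, expansion, ← mul_div_assoc, ← sum_espProb_mul_card_symmDiff]
  gcongr with S'
  · exact G.espProb_nonneg S S'
  · rw [mul_div_left_comm]
    exact mul_le_of_le_one_right (Nat.cast_nonneg _) (div_self_le_one _)

lemma biasedStep_apply [DecidableEq V] {S : Finset V} (hS : S.Nonempty) (S' : Finset V) :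
    G.biasedStep S S' = ENNReal.ofReal (G.biasedProb S S') := by
  have hS0 : (0 : ℝ) < S.card := by exact_mod_cast hS.card_pos
  rw [biasedStep, dif_pos hS, PMF.ofFintype_apply, biasedProb, ENNReal.ofReal_div_of_pos hS0,
    mul_comm (G.espProb S S'), ENNReal.ofReal_mul (Nat.cast_nonneg _), espProb,
    ENNReal.ofReal_toReal (G.espKernel_ne_top S S'), ENNReal.ofReal_natCast,
    ENNReal.ofReal_natCast]

lemma nonempty_of_biasedStep_ne_zero [DecidableEq V] {S S' : Finset V} (hS : S.Nonempty)
    (h : G.biasedStep S S' ≠ 0) : S'.Nonempty := by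
  rw [Finset.nonempty_iff_ne_empty]
  rintro rfl
  simp [G.biasedStep_apply hS, biasedProb] at h

lemma pmfMean_biasedStep_le [DecidableEq V] {S : Finset V} (hS : S.Nonempty)
    {g : Finset V → ℝ≥0∞} {f : Finset V → ℝ} (hf : ∀ S', S'.Nonempty → 0 ≤ f S')
    (hg : ∀ S', S'.Nonempty → g S' ≤ ENNReal.ofReal (f S')) :
    pmfMean (G.biasedStep S) g ≤ ENNReal.ofReal (∑ S', G.biasedProb S S' * f S') := by
  have h_empty : G.biasedProb S ∅ = 0 := by simp [biasedProb]
  rw [pmfMean, tsum_fintype, ENNReal.ofReal_sum_of_nonneg]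
  · refine Finset.sum_le_sum fun S' _ => ?_
    rw [G.biasedStep_apply hS, ENNReal.ofReal_mul (G.biasedProb_nonneg _ _)]
    rcases S'.eq_empty_or_nonempty with rfl | hS'
    · simp [h_empty]
    · gcongr
      exact hg S' hS'
  · intro S' _
    rcases S'.eq_empty_or_nonempty with rfl | hS'
    · simp [h_empty]
    · exact mul_nonneg (G.biasedProb_nonneg _ _) (hf S' hS')

variable {G}

lemma IsLazy.sum_biasedProb_mul_sqrt_le [DecidableEq V] (hG : G.IsLazy) {S : Finset V}
    (hS : S.Nonempty) :
    ∑ S', G.biasedProb S S' * √((S.card : ℝ) / S'.card) ≤ 1 - G.Psi S / 24 := by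
  refine le_trans (Finset.sum_le_sum fun S' _ => le_of_eq ?_) (hG.sum_espProb_mul_sqrt_le hS)
  rw [biasedProb, mul_div_assoc, mul_assoc, ← inv_div, Real.sqrt_inv, inv_mul_eq_div,
    Real.sqrt_div_self]

lemma IsLazy.log_card_add_le_sum_biasedProb_mul_log [DecidableEq V] (hG : G.IsLazy)
    {S : Finset V} (hS : S.Nonempty) :
    Real.log S.card + G.Psi S / 12 ≤ ∑ S', G.biasedProb S S' * Real.log S'.card := by
  have hS0 : (0 : ℝ) < S.card := by exact_mod_cast hS.card_pos
  have h_log (S' : Finset V) (hS' : S'.Nonempty) :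
      Real.log S.card + 2 - 2 * √((S.card : ℝ) / S'.card) ≤ Real.log S'.card := by
    have hS'0 : (0 : ℝ) < S'.card := by exact_mod_cast hS'.card_pos
    have h := Real.log_le_sub_one_of_pos (Real.sqrt_pos.2 (div_pos hS0 hS'0))
    rw [Real.log_sqrt (by positivity), Real.log_div hS0.ne' hS'0.ne'] at h
    linarith
  calc Real.log S.card + G.Psi S / 12
      ≤ Real.log S.card + 2 - 2 * ∑ S', G.biasedProb S S' * √((S.card : ℝ) / S'.card) := by
        linarith [hG.sum_biasedProb_mul_sqrt_le hS]
    _ = ∑ S', G.biasedProb S S' * (Real.log S.card + 2 - 2 * √((S.card : ℝ) / S'.card)) := by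
        simp only [mul_sub, Finset.sum_sub_distrib, ← Finset.sum_mul, G.sum_biasedProb hS,
          mul_left_comm _ (2 : ℝ), ← Finset.mul_sum, one_mul]
    _ ≤ _ := by
        refine Finset.sum_le_sum fun S' _ => ?_
        rcases S'.eq_empty_or_nonempty with rfl | hS'
        · simp [biasedProb]
        · exact mul_le_mul_of_nonneg_left (h_log S' hS') (G.biasedProb_nonneg S S')

end BiasedSteps

section QuadraticForm

variable {V : Type*} [Fintype V] (G : RegularGraph V)

lemma sum_sum_w_mul_add_mul_sq (c : ℝ) (f : V → ℝ) :
    ∑ x, ∑ y, G.w x y * (f x + c * f y) ^ 2 =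
      (1 + c ^ 2) * ∑ x, f x ^ 2 + 2 * c * ∑ x, ∑ y, G.w x y * (f x * f y) := by
  have h_left : ∑ x, ∑ y, G.w x y * f x ^ 2 = ∑ x, f x ^ 2 := by
    simp only [← Finset.sum_mul, G.degree_eq_one, one_mul]
  have h_right : ∑ x, ∑ y, G.w x y * f y ^ 2 = ∑ x, f x ^ 2 := by
    rw [Finset.sum_comm, ← h_left]
    simp only [G.symm]
  have h_expand (x y : V) : G.w x y * (f x + c * f y) ^ 2 =
      G.w x y * f x ^ 2 + c ^ 2 * (G.w x y * f y ^ 2) + 2 * c * (G.w x y * (f x * f y)) := by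
    ring
  simp only [h_expand, Finset.sum_add_distrib, ← Finset.mul_sum, h_left, h_right]
  ring

lemma sum_sum_w_mul_mul_le (f : V → ℝ) :
    ∑ x, ∑ y, G.w x y * (f x * f y) ≤ ∑ x, f x ^ 2 := by
  have h_nonneg : 0 ≤ ∑ x, ∑ y, G.w x y * (f x + -1 * f y) ^ 2 :=
    Finset.sum_nonneg fun x _ => Finset.sum_nonneg fun y _ =>
      mul_nonneg (G.nonneg x y) (sq_nonneg _)
  linarith [G.sum_sum_w_mul_add_mul_sq (-1) f]

variable {G} in
lemma IsLazy.sum_sum_w_mul_mul_nonneg (hG : G.IsLazy) (f : V → ℝ) :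
    0 ≤ ∑ x, ∑ y, G.w x y * (f x * f y) := by
  have h_diag : 2 * ∑ x, f x ^ 2 ≤ ∑ x, ∑ y, G.w x y * (f x + 1 * f y) ^ 2 := by
    rw [Finset.mul_sum]
    refine Finset.sum_le_sum fun x _ => le_trans ?_ (Finset.single_le_sum
      (fun y _ => mul_nonneg (G.nonneg x y) (sq_nonneg _)) (Finset.mem_univ x))
    nlinarith [hG x, sq_nonneg (f x)]
  linarith [G.sum_sum_w_mul_add_mul_sq 1 f]

end QuadraticForm

section KilledWalk

variable {V : Type*} [Fintype V] [DecidableEq V] (G : RegularGraph V)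

/-- The probability that the random walk started at a vertex stays in `A` for `t` steps. -/
def stayProb (A : Finset V) : ℕ → V → ℝ
  | 0, x => if x ∈ A then 1 else 0
  | t + 1, x => if x ∈ A then ∑ y, G.w x y * stayProb A t y else 0

lemma stayProb_nonneg (A : Finset V) (t : ℕ) (x : V) : 0 ≤ G.stayProb A t x := by
  induction t generalizing x with
  | zero => unfold stayProb; positivity
  | succ t ih =>
    unfold stayProb
    split_ifs
    exacts [Finset.sum_nonneg fun y _ => mul_nonneg (G.nonneg x y) (ih y), le_rfl]

lemma stayProb_of_notMem {A : Finset V} {x : V} (hx : x ∉ A) (t : ℕ) : G.stayProb A t x = 0 := by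
  cases t <;> exact if_neg hx

lemma stayProb_succ_le (A : Finset V) (t : ℕ) (x : V) :
    G.stayProb A (t + 1) x ≤ ∑ y, G.w x y * G.stayProb A t y := by
  rw [stayProb]
  split_ifs
  · rfl
  · exact Finset.sum_nonneg fun y _ => mul_nonneg (G.nonneg x y) (G.stayProb_nonneg A t y)

lemma stayProb_le_one (A : Finset V) (t : ℕ) (x : V) : G.stayProb A t x ≤ 1 := by
  induction t generalizing x with
  | zero => unfold stayProb; split_ifs <;> norm_num
  | succ t ih =>
    calc G.stayProb A (t + 1) x ≤ ∑ y, G.w x y * G.stayProb A t y := G.stayProb_succ_le A t x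
      _ ≤ ∑ y, G.w x y :=
          Finset.sum_le_sum fun y _ => mul_le_of_le_one_right (G.nonneg x y) (ih y)
      _ = 1 := G.degree_eq_one x

lemma sum_stayProb_le_card (A S : Finset V) (t : ℕ) : ∑ x ∈ S, G.stayProb A t x ≤ A.card := by
  calc ∑ x ∈ S, G.stayProb A t x ≤ ∑ x, G.stayProb A t x :=
        Finset.sum_le_univ_sum_of_nonneg fun x => G.stayProb_nonneg A t x
    _ = ∑ x ∈ A, G.stayProb A t x := .symm <| Finset.sum_subset A.subset_univ
        fun x _ hx => G.stayProb_of_notMem hx t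
    _ ≤ A.card • (1 : ℝ) := Finset.sum_le_card_nsmul _ _ _ fun x _ => G.stayProb_le_one A t x
    _ = A.card := by rw [nsmul_one]

/-- The transition operator of the random walk killed outside of `A`. -/
def killedWalk (A : Finset V) : EuclideanSpace ℝ V →ₗ[ℝ] EuclideanSpace ℝ V :=
  Matrix.toEuclideanLin (Matrix.of fun x y => if x ∈ A ∧ y ∈ A then G.w x y else 0)

/-- The indicator vector of a set of vertices. -/
def indicatorVec (B : Finset V) : EuclideanSpace ℝ V :=
  WithLp.toLp 2 fun x => if x ∈ B then 1 else 0

lemma killedWalk_apply (A : Finset V) (u : EuclideanSpace ℝ V) (x : V) :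
    G.killedWalk A u x = ∑ y, (if x ∈ A ∧ y ∈ A then G.w x y else 0) * u y := by
  simp [killedWalk, Matrix.toLpLin_apply, Matrix.mulVec, dotProduct]

lemma inner_killedWalk (A : Finset V) (u v : EuclideanSpace ℝ V) :
    inner ℝ u (G.killedWalk A v) = ∑ x, ∑ y,
      G.w x y * ((if x ∈ A then u x else 0) * (if y ∈ A then v y else 0)) := by
  simp only [PiLp.inner_apply, killedWalk_apply, RCLike.inner_apply, conj_trivial, Finset.sum_mul]
  refine Finset.sum_congr rfl fun x _ => Finset.sum_congr rfl fun y _ => ?_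
  by_cases hx : x ∈ A <;> by_cases hy : y ∈ A <;> simp [hx, hy]
  ring

lemma isSymmetric_killedWalk (A : Finset V) : (G.killedWalk A).IsSymmetric := fun u v => by
  rw [real_inner_comm, inner_killedWalk, inner_killedWalk, Finset.sum_comm]
  exact Finset.sum_congr rfl fun x _ => Finset.sum_congr rfl fun y _ => by rw [G.symm]; ring

variable {G} in
lemma IsLazy.isPositive_killedWalk (hG : G.IsLazy) (A : Finset V) :
    (G.killedWalk A).IsPositive := by
  refine ⟨G.isSymmetric_killedWalk A, fun u => ?_⟩
  rw [G.isSymmetric_killedWalk A, inner_killedWalk]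
  exact hG.sum_sum_w_mul_mul_nonneg _

lemma isPositive_one_sub_killedWalk (A : Finset V) : (1 - G.killedWalk A).IsPositive := by
  refine ⟨LinearMap.IsSymmetric.one.sub (G.isSymmetric_killedWalk A), fun u => ?_⟩
  have h_norm : ∑ x, (if x ∈ A then u x else 0) ^ 2 ≤ ‖u‖ ^ 2 := by
    rw [EuclideanSpace.real_norm_sq_eq]
    refine Finset.sum_le_sum fun x _ => ?_
    split_ifs
    · rfl
    · simpa using sq_nonneg (u x)
  rw [LinearMap.sub_apply, Module.End.one_apply, inner_sub_left, real_inner_self_eq_norm_sq,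
    real_inner_comm, inner_killedWalk]
  exact sub_nonneg.2 ((G.sum_sum_w_mul_mul_le _).trans h_norm)

lemma sq_norm_indicatorVec (B : Finset V) : ‖indicatorVec B‖ ^ 2 = (B.card : ℝ) := by
  simp [EuclideanSpace.real_norm_sq_eq, indicatorVec]

lemma inner_indicatorVec (B : Finset V) (u : EuclideanSpace ℝ V) :
    inner ℝ (indicatorVec B) u = ∑ x ∈ B, u x := by
  simp [PiLp.inner_apply, indicatorVec]

lemma inner_indicatorVec_killedWalk (A : Finset V) :
    inner ℝ (indicatorVec A) (G.killedWalk A (indicatorVec A)) = G.weight A A := by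
  simp [inner_killedWalk, indicatorVec, weight]

lemma killedWalk_pow_indicatorVec_le {A B : Finset V} (hB : B ⊆ A) (t : ℕ) (x : V) :
    ((G.killedWalk A) ^ t) (indicatorVec B) x ≤ G.stayProb A t x := by
  induction t generalizing x with
  | zero =>
    change (if x ∈ B then (1 : ℝ) else 0) ≤ if x ∈ A then 1 else 0
    split_ifs with h1 h2
    exacts [le_rfl, absurd (hB h1) h2, zero_le_one, le_rfl]
  | succ t ih =>
    rw [pow_succ', Module.End.mul_apply, killedWalk_apply, stayProb]
    by_cases hx : x ∈ A
    · simp only [hx, true_and, if_true]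
      refine Finset.sum_le_sum fun y _ => ?_
      by_cases hy : y ∈ A
      · simpa only [hy, if_true] using mul_le_mul_of_nonneg_left (ih y) (G.nonneg x y)
      · simp only [hy, if_false, zero_mul, G.stayProb_of_notMem hy, mul_zero, le_refl]
    · simp only [hx, false_and, if_false, zero_mul, Finset.sum_const_zero, le_refl]

lemma expansion_mul_card (S : Finset V) : G.expansion S * S.card = G.weight S Sᶜ :=
  div_mul_cancel_of_imp fun h => by simp_all [weight]

variable {G}

lemma IsLazy.pow_mul_card_le_sum_stayProb (hG : G.IsLazy) {A B : Finset V} (hB : B ⊆ A)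
    (h_card : A.card ≤ 2 * B.card) (hφ0 : 0 < G.expansion A) (hφ1 : 8 * G.expansion A ≤ 1)
    (t : ℕ) :
    (1 - 8 * G.expansion A) ^ t / 8 * B.card ≤ ∑ x ∈ B, G.stayProb A t x := by
  have h_spectral := one_sub_pow_mul_sq_norm_le_eight_mul_re_inner_pow (x := indicatorVec B)
    (z := indicatorVec A) (hG.isPositive_killedWalk A) (G.isPositive_one_sub_killedWalk A)
    (mul_pos (by norm_num) hφ0) hφ1 ?_ ?_ ?_ t
  · rw [sq_norm_indicatorVec, RCLike.re_to_real, inner_indicatorVec] at h_spectral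
    have := Finset.sum_le_sum fun x (_ : x ∈ B) => G.killedWalk_pow_indicatorVec_le hB t x
    linarith
  · simp only [inner_indicatorVec, sq_norm_indicatorVec, RCLike.ofReal_real_eq_id, id]
    simp [indicatorVec, Finset.inter_eq_left.2 hB]
  · rw [sq_norm_indicatorVec, sq_norm_indicatorVec]
    exact_mod_cast h_card
  · rw [sq_norm_indicatorVec, RCLike.re_to_real, inner_indicatorVec_killedWalk]
    linarith [G.weight_self_add_weight_compl A, G.expansion_mul_card A]

lemma IsLazy.half_pow_le_stayProb (hG : G.IsLazy) {A : Finset V} {x : V} (hx : x ∈ A) (t : ℕ) :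
    (1 / 2 : ℝ) ^ t ≤ G.stayProb A t x := by
  induction t with
  | zero => rw [pow_zero, stayProb, if_pos hx]
  | succ t ih =>
    rw [stayProb, if_pos hx]
    calc (1 / 2 : ℝ) ^ (t + 1) = 1 / 2 * (1 / 2) ^ t := by ring
      _ ≤ G.w x x * G.stayProb A t x := mul_le_mul (hG x) ih (by positivity) (G.nonneg x x)
      _ ≤ _ := Finset.single_le_sum (f := fun y => G.w x y * G.stayProb A t y)
          (fun y _ => mul_nonneg (G.nonneg x y) (G.stayProb_nonneg A t y)) (Finset.mem_univ x)

lemma IsLazy.exists_subset_exp_le_stayProb (hG : G.IsLazy) {A : Finset V}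
    (hφ : 0 < G.expansion A) (t : ℕ) :
    ∃ A' ⊆ A, A.card ≤ 2 * A'.card ∧
      ∀ v ∈ A', Real.exp (-(16 * G.expansion A * t)) / 8 ≤ G.stayProb A t v := by
  rcases le_total (G.expansion A) (1 / 16) with h | h
  · have h_exp : Real.exp (-(16 * G.expansion A * t)) ≤ (1 - 8 * G.expansion A) ^ t := by
      calc Real.exp (-(16 * G.expansion A * t))
          = Real.exp (-(2 * (8 * G.expansion A))) ^ t := by rw [← Real.exp_nat_mul]; ring_nf
        _ ≤ _ := by gcongr; exact exp_neg_two_mul_le_one_sub (by linarith) (by linarith)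
    refine ⟨_, Finset.filter_subset _ _, card_le_two_mul_card_filter_le fun B hB h_card =>
      hG.pow_mul_card_le_sum_stayProb hB h_card hφ (by linarith) t, fun v hv => ?_⟩
    exact (div_le_div_of_nonneg_right h_exp (by norm_num)).trans (Finset.mem_filter.1 hv).2
  · refine ⟨A, subset_rfl, by omega, fun v hv => le_trans ?_ (hG.half_pow_le_stayProb hv t)⟩
    calc Real.exp (-(16 * G.expansion A * t)) / 8 ≤ Real.exp (-(16 * G.expansion A * t)) :=
          div_le_self (Real.exp_pos _).le (by norm_num)
      _ ≤ Real.exp (-1) ^ t := by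
          rw [← Real.exp_nat_mul]
          gcongr
          nlinarith
      _ ≤ (1 / 2) ^ t := by
          gcongr
          exact Real.exp_neg_one_lt_d9.le.trans (by norm_num)

end KilledWalk

section Failure

variable {V : Type*} [Fintype V] [DecidableEq V] (G : RegularGraph V)

lemma runCopy_mem_support {K θ : ℝ} {T : ℕ} {S S₁ : Finset V} {m : ℕ} (hS : S.Nonempty)
    (h : (some S₁, m) ∈ (G.runCopy K θ T S).support) :
    S₁.Nonempty ∧ (S₁.card : ℝ) ≤ K ∧ G.Psi S₁ ≤ θ := by
  induction T generalizing S m with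
  | zero =>
    rw [runCopy] at h
    split_ifs at h with h_done <;> simp_all
  | succ T ih =>
    rw [runCopy] at h
    split_ifs at h with h_done
    · simp_all
    obtain ⟨S', hS', h⟩ := (PMF.mem_support_bind_iff _ _ _).1 h
    split_ifs at h with hK
    · obtain ⟨⟨_, _⟩, h_tail, h_eq⟩ := (PMF.mem_support_map_iff _ _ _).1 h
      obtain ⟨rfl, -⟩ := Prod.mk.inj h_eq
      exact ih (G.nonempty_of_biasedStep_ne_zero hS hS') h_tail
    · simp at h

lemma runCopies_mem_support {K θ : ℝ} {T N : ℕ} {v : V} {S : Finset V} {m : ℕ}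
    (h : (some S, m) ∈ (G.runCopies K θ T v N).support) :
    S.Nonempty ∧ (S.card : ℝ) ≤ K ∧ G.Psi S ≤ θ := by
  induction N generalizing m with
  | zero => simp [runCopies] at h
  | succ N ih =>
    rw [runCopies] at h
    obtain ⟨⟨_ | S₁, t⟩, h_copy, h⟩ := (PMF.mem_support_bind_iff _ _ _).1 h
    · obtain ⟨⟨_, _⟩, h_tail, h_eq⟩ := (PMF.mem_support_map_iff _ _ _).1 h
      obtain ⟨rfl, -⟩ := Prod.mk.inj h_eq
      exact ih h_tail
    · obtain ⟨h_eq, -⟩ : S = S₁ ∧ _ := by simpa using h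
      exact h_eq ▸ G.runCopy_mem_support (Finset.singleton_nonempty v) h_copy

lemma runCopies_toOuterMeasure_none (K θ : ℝ) (T : ℕ) (v : V) (N : ℕ) :
    (G.runCopies K θ T v N).toOuterMeasure {r | r.1 = none} =
      (G.runCopy K θ T {v}).toOuterMeasure {r | r.1 = none} ^ N := by
  induction N with
  | zero => simp [runCopies]
  | succ N ih =>
    rw [runCopies, PMF.toOuterMeasure_bind_apply, pow_succ', ← ih, PMF.toOuterMeasure_apply,
      ← ENNReal.tsum_mul_right]
    refine tsum_congr ?_
    rintro ⟨_ | S, t⟩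
    · simp only [PMF.toOuterMeasure_map_apply, Set.mem_ofPred_eq, Set.indicator_of_mem]
      rfl
    · simp

/-- An upper bound for the probability that a copy in state `S`, with `t` steps to go, returns
nothing.  A copy that does not stop within `t` steps either leaves the sets of size at most `K`, or
stays on sets with `Ψ > θ`; the average of `stayProb A` over the current set is then small in the
first case because that set is large compared to `A`, while the last summand controls the
second case. -/
def failureBound (A : Finset V) (K θ : ℝ) (t : ℕ) (S : Finset V) : ℝ :=
  1 - (∑ x ∈ S, G.stayProb A t x) / S.card + A.card / K +
    √(K / S.card) * Real.exp (-(θ * t / 24))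

lemma sum_stayProb_div_card_le_one (A S : Finset V) (t : ℕ) :
    (∑ x ∈ S, G.stayProb A t x) / S.card ≤ 1 := by
  refine div_le_one_of_le₀ ?_ (Nat.cast_nonneg _)
  simpa using Finset.sum_le_card_nsmul S _ 1 fun x _ => G.stayProb_le_one A t x

lemma failureBound_nonneg (A : Finset V) {K : ℝ} (hK : 0 ≤ K) (θ : ℝ) (t : ℕ) (S : Finset V) :
    0 ≤ G.failureBound A K θ t S := by
  have := sub_nonneg.2 (G.sum_stayProb_div_card_le_one A S t)
  unfold failureBound
  positivity

lemma one_le_failureBound_of_card_le (A : Finset V) {K : ℝ} (θ : ℝ) {S : Finset V}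
    (hS : S.Nonempty) (hSK : (S.card : ℝ) ≤ K) : 1 ≤ G.failureBound A K θ 0 S := by
  have hS0 : (0 : ℝ) < S.card := by exact_mod_cast hS.card_pos
  have h_sqrt : 1 ≤ √(K / S.card) := Real.one_le_sqrt.2 ((one_le_div hS0).2 hSK)
  have h_div : 0 ≤ (A.card : ℝ) / K := div_nonneg (Nat.cast_nonneg _) (hS0.le.trans hSK)
  simp only [failureBound, Nat.cast_zero, mul_zero, zero_div, neg_zero, Real.exp_zero, mul_one]
  linarith [G.sum_stayProb_div_card_le_one A S 0]

lemma one_le_failureBound_of_lt_card (A : Finset V) {K : ℝ} (hK : 0 < K) (θ : ℝ) (t : ℕ)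
    {S : Finset V} (hSK : K < S.card) : 1 ≤ G.failureBound A K θ t S := by
  have h_avg : (∑ x ∈ S, G.stayProb A t x) / S.card ≤ A.card / K :=
    div_le_div₀ (Nat.cast_nonneg _) (G.sum_stayProb_le_card A S t) hK hSK.le
  have h_error : 0 ≤ √(K / S.card) * Real.exp (-(θ * t / 24)) := by positivity
  unfold failureBound
  linarith

variable {G}

lemma IsLazy.sum_biasedProb_mul_failureBound_le (hG : G.IsLazy) (A : Finset V) (K : ℝ) {θ : ℝ}
    (t : ℕ) {S : Finset V} (hS : S.Nonempty) (hθ : θ ≤ G.Psi S) :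
    ∑ S', G.biasedProb S S' * G.failureBound A K θ t S' ≤ G.failureBound A K θ (t + 1) S := by
  have hS0 : (S.card : ℝ) ≠ 0 := by exact_mod_cast hS.card_ne_zero
  have h_sqrt (S' : Finset V) : √(K / S'.card) = √((S.card : ℝ) / S'.card) * √(K / S.card) := by
    rw [← Real.sqrt_mul (by positivity), mul_comm, div_mul_div_cancel₀ hS0]
  have h_avg : (∑ x ∈ S, G.stayProb A (t + 1) x) / S.card ≤
      (∑ x ∈ S, ∑ y, G.w x y * G.stayProb A t y) / S.card := by
    gcongr with x
    exact G.stayProb_succ_le A t x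
  have h_decay : ∑ S', G.biasedProb S S' * √((S.card : ℝ) / S'.card) ≤ Real.exp (-(θ / 24)) := by
    linarith [hG.sum_biasedProb_mul_sqrt_le hS, Real.add_one_le_exp (-(θ / 24))]
  calc ∑ S', G.biasedProb S S' * G.failureBound A K θ t S'
      = 1 + A.card / K - (∑ x ∈ S, ∑ y, G.w x y * G.stayProb A t y) / S.card +
        (∑ S', G.biasedProb S S' * √((S.card : ℝ) / S'.card)) *
          (√(K / S.card) * Real.exp (-(θ * t / 24))) := by
        have h_const : 1 + A.card / K = ∑ S', G.biasedProb S S' * (1 + A.card / K) := by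
          rw [← Finset.sum_mul, G.sum_biasedProb hS, one_mul]
        rw [h_const, ← sum_biasedProb_mul_average, Finset.sum_mul, ← Finset.sum_sub_distrib,
          ← Finset.sum_add_distrib]
        refine Finset.sum_congr rfl fun S' _ => ?_
        rw [failureBound, h_sqrt]
        ring
    _ ≤ 1 + A.card / K - (∑ x ∈ S, G.stayProb A (t + 1) x) / S.card +
        Real.exp (-(θ / 24)) * (√(K / S.card) * Real.exp (-(θ * t / 24))) := by
        gcongr
    _ = G.failureBound A K θ (t + 1) S := by
        have h_exp : Real.exp (-(θ * (t + 1 : ℕ) / 24)) =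
            Real.exp (-(θ / 24)) * Real.exp (-(θ * t / 24)) := by
          rw [← Real.exp_add]
          push_cast
          ring_nf
        rw [failureBound, h_exp]
        ring

lemma IsLazy.runCopy_toOuterMeasure_none_le (hG : G.IsLazy) (A : Finset V) {K : ℝ} (hK : 0 < K)
    (θ : ℝ) (T : ℕ) {S : Finset V} (hS : S.Nonempty) (hSK : (S.card : ℝ) ≤ K) :
    (G.runCopy K θ T S).toOuterMeasure {r | r.1 = none} ≤
      ENNReal.ofReal (G.failureBound A K θ T S) := by
  induction T generalizing S with
  | zero =>
    rw [runCopy]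
    split_ifs with h_done
    · simp
    · simpa using G.one_le_failureBound_of_card_le A θ hS hSK
  | succ T ih =>
    rw [runCopy]
    split_ifs with h_done
    · simp
    have hΨ : θ ≤ G.Psi S := le_of_not_ge fun h => h_done ⟨hSK, h⟩
    rw [PMF.toOuterMeasure_bind_apply]
    refine (G.pmfMean_biasedStep_le hS (fun S' _ => G.failureBound_nonneg A hK.le θ T S')
      fun S' hS' => ?_).trans
      (ENNReal.ofReal_le_ofReal (hG.sum_biasedProb_mul_failureBound_le A K T hS hΨ))
    split_ifs with hS'K
    · rw [PMF.toOuterMeasure_map_apply]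
      exact ih hS' hS'K
    · simpa using G.one_le_failureBound_of_lt_card A hK θ T (not_le.1 hS'K)

end Failure

section RunningTime

variable {V : Type*} [Fintype V] (G : RegularGraph V)

lemma deg_le_maxDeg (x : V) : G.deg x ≤ G.maxDeg := Finset.le_sup (f := G.deg) (Finset.mem_univ x)

lemma log_card_le_log_card (S : Finset V) : Real.log S.card ≤ Real.log (Fintype.card V) := by
  rcases S.eq_empty_or_nonempty with rfl | hS
  · simpa using Real.log_natCast_nonneg _
  · exact Real.log_le_log (by exact_mod_cast hS.card_pos) (by exact_mod_cast S.card_le_univ)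

/-- An upper bound for the expected value of the sum of `|S ∆ S'| / |S'|` over the next `t` steps
`S → S'` of the volume-biased process from `S`.  The expectation of a single summand is at most
`2 φ(S) ≤ α + φ(S) ^ 2 / α`, and the last term is paid for by the growth of `log |S|`. -/
def changeBound (α : ℝ) (t : ℕ) (S : Finset V) : ℝ :=
  α * t + 12 / α * (Real.log (Fintype.card V) - Real.log S.card)

lemma changeBound_nonneg {α : ℝ} (hα : 0 ≤ α) (t : ℕ) (S : Finset V) :
    0 ≤ changeBound α t S := by
  have := sub_nonneg.2 (log_card_le_log_card S)
  unfold changeBound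
  positivity

variable {G}

lemma IsLazy.one_le_maxDeg (hG : G.IsLazy) (v : V) : 1 ≤ G.maxDeg := by
  refine le_trans (Finset.card_pos.2 ⟨v, ?_⟩) (G.deg_le_maxDeg v)
  simpa using lt_of_lt_of_le (by norm_num) (hG v)

variable [DecidableEq V]

lemma IsLazy.sum_biasedProb_mul_changeBound_le (hG : G.IsLazy) {α : ℝ} (hα : 0 < α) (t : ℕ)
    {S : Finset V} (hS : S.Nonempty) :
    ∑ S', G.biasedProb S S' * ((symmDiff S S').card / S'.card + changeBound α t S') ≤
      changeBound α (t + 1) S := by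
  have h_amgm : 2 * G.expansion S ≤ α + G.expansion S ^ 2 / α := by
    have h : α + G.expansion S ^ 2 / α - 2 * G.expansion S = (α - G.expansion S) ^ 2 / α := by
      field_simp
      ring
    linarith [div_nonneg (sq_nonneg (α - G.expansion S)) hα.le]
  have h_log : Real.log S.card + G.expansion S ^ 2 / 12 ≤
      ∑ S', G.biasedProb S S' * Real.log S'.card := by
    linarith [hG.log_card_add_le_sum_biasedProb_mul_log hS, hG.sq_expansion_le_Psi S]
  calc ∑ S', G.biasedProb S S' * ((symmDiff S S').card / S'.card + changeBound α t S')
      = ∑ S', G.biasedProb S S' * ((symmDiff S S').card / S'.card : ℝ) +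
          (α * t + 12 / α * Real.log (Fintype.card V) -
            12 / α * ∑ S', G.biasedProb S S' * Real.log S'.card) := by
        rw [← one_mul (_ + 12 / α * Real.log _), ← G.sum_biasedProb hS, Finset.mul_sum,
          Finset.sum_mul, ← Finset.sum_sub_distrib, ← Finset.sum_add_distrib]
        refine Finset.sum_congr rfl fun S' _ => ?_
        rw [changeBound]
        ring
    _ ≤ 2 * G.expansion S + (α * t + 12 / α * Real.log (Fintype.card V) -
            12 / α * (Real.log S.card + G.expansion S ^ 2 / 12)) := by
        gcongr
        exact G.sum_biasedProb_mul_card_symmDiff_div_card_le S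
    _ = 2 * G.expansion S - G.expansion S ^ 2 / α +
          (α * t + 12 / α * (Real.log (Fintype.card V) - Real.log S.card)) := by ring
    _ ≤ changeBound α (t + 1) S := by
        rw [changeBound]
        push_cast
        linarith

lemma IsLazy.moveCost_le (hG : G.IsLazy) (S S' : Finset V) :
    G.moveCost S S' ≤ 2 * G.opCost * G.maxDeg * (symmDiff S S').card := by
  unfold moveCost
  split_ifs with h
  · exact Nat.zero_le _
  obtain ⟨v, hv⟩ : (symmDiff S S').Nonempty :=
    Finset.symmDiff_nonempty.2 (Ne.symm h)
  have h_pos : 1 ≤ (symmDiff S S').card * G.maxDeg :=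
    Nat.mul_pos (Finset.card_pos.2 ⟨v, hv⟩) (hG.one_le_maxDeg v)
  have h_deg : ∑ x ∈ symmDiff S S', G.deg x ≤ (symmDiff S S').card * G.maxDeg :=
    Finset.sum_le_card_nsmul _ _ _ fun x _ => G.deg_le_maxDeg x
  calc G.opCost * (1 + ∑ x ∈ symmDiff S S', G.deg x)
      ≤ G.opCost * ((symmDiff S S').card * G.maxDeg + (symmDiff S S').card * G.maxDeg) := by gcongr
    _ = 2 * G.opCost * G.maxDeg * (symmDiff S S').card := by ring

lemma IsLazy.moveCost_le_mul_div (hG : G.IsLazy) {K : ℝ} {S S' : Finset V} (hS' : S'.Nonempty)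
    (hS'K : (S'.card : ℝ) ≤ K) :
    (G.moveCost S S' : ℝ) ≤
      2 * G.opCost * G.maxDeg * K * ((symmDiff S S').card / S'.card) := by
  have hS'0 : (0 : ℝ) < S'.card := by exact_mod_cast hS'.card_pos
  calc (G.moveCost S S' : ℝ) ≤ 2 * G.opCost * G.maxDeg * (symmDiff S S').card := by
        exact_mod_cast hG.moveCost_le S S'
    _ = 2 * G.opCost * G.maxDeg * S'.card * ((symmDiff S S').card / S'.card) := by
        rw [mul_assoc _ (S'.card : ℝ), mul_div_cancel₀ _ hS'0.ne']
    _ ≤ _ := by gcongr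

lemma IsLazy.pmfMean_runCopy_le (hG : G.IsLazy) {K α : ℝ} (hK : 0 ≤ K) (θ : ℝ) (hα : 0 < α)
    (T : ℕ) {S : Finset V} (hS : S.Nonempty) :
    pmfMean (G.runCopy K θ T S) (fun r => (r.2 : ℝ≥0∞)) ≤
      ENNReal.ofReal (G.opCost + 2 * G.opCost * G.maxDeg * K * changeBound α T S) := by
  have h_nonneg (t : ℕ) (S : Finset V) : 0 ≤ 2 * G.opCost * G.maxDeg * K * changeBound α t S :=
    mul_nonneg (by positivity) (changeBound_nonneg hα.le t S)
  induction T generalizing S with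
  | zero =>
    rw [runCopy]
    split_ifs <;> simp [pmfMean_pure]
  | succ T ih =>
    rw [runCopy]
    split_ifs with h_done
    · simp [pmfMean_pure]
    rw [pmfMean_bind]
    refine (G.pmfMean_biasedStep_le hS (f := fun S' => G.opCost + 2 * G.opCost * G.maxDeg * K *
      ((symmDiff S S').card / S'.card + changeBound α T S')) (fun S' _ => ?_)
      fun S' hS' => ?_).trans (ENNReal.ofReal_le_ofReal ?_)
    · have := changeBound_nonneg hα.le T S'
      positivity
    · split_ifs with hS'K
      · simp only [pmfMean_map, Function.comp_def, Nat.cast_add, pmfMean_add, pmfMean_const]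
        refine (add_le_add_right (ih hS') _).trans ?_
        rw [← ENNReal.ofReal_natCast, ← ENNReal.ofReal_add (Nat.cast_nonneg _)
          (add_nonneg (Nat.cast_nonneg _) (h_nonneg T S'))]
        refine ENNReal.ofReal_le_ofReal ?_
        linarith [hG.moveCost_le_mul_div (S := S) hS' hS'K]
      · have := changeBound_nonneg hα.le T S'
        rw [pmfMean_pure, ← ENNReal.ofReal_natCast]
        exact ENNReal.ofReal_le_ofReal (le_add_of_nonneg_right (by positivity))
    · simp only [mul_add _ (G.opCost : ℝ), mul_left_comm _ (2 * _ * _ * K), ← Finset.mul_sum,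
        Finset.sum_add_distrib, ← Finset.sum_mul, G.sum_biasedProb hS, one_mul]
      gcongr
      exact hG.sum_biasedProb_mul_changeBound_le hα T hS

variable (G)

lemma pmfMean_runCopies_le (K θ : ℝ) (T : ℕ) (v : V) (N : ℕ) :
    pmfMean (G.runCopies K θ T v N) (fun r => (r.2 : ℝ≥0∞)) ≤
      N * ((G.opCost * (1 + G.deg v) : ℕ) +
        pmfMean (G.runCopy K θ T {v}) (fun r => (r.2 : ℝ≥0∞))) := by
  induction N with
  | zero => simp [runCopies, pmfMean_pure]
  | succ N ih =>
    set start := G.opCost * (1 + G.deg v)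
    calc pmfMean (G.runCopies K θ T v (N + 1)) (fun r => (r.2 : ℝ≥0∞))
        ≤ pmfMean (G.runCopy K θ T {v}) (fun r => (start : ℝ≥0∞) + r.2 +
          pmfMean (G.runCopies K θ T v N) (fun r => (r.2 : ℝ≥0∞))) := by
          rw [runCopies, pmfMean_bind]
          refine pmfMean_mono _ ?_
          rintro ⟨_ | S, t⟩
          · simp only [pmfMean_map, Function.comp_def, Nat.cast_add, pmfMean_add, pmfMean_const]
            rfl
          · simp only [pmfMean_pure, Nat.cast_add]
            exact le_self_add
      _ = start + pmfMean (G.runCopy K θ T {v}) (fun r => (r.2 : ℝ≥0∞)) +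
          pmfMean (G.runCopies K θ T v N) (fun r => (r.2 : ℝ≥0∞)) := by
          simp only [pmfMean_add, pmfMean_const]
      _ ≤ _ := by
          grw [ih]
          push_cast
          exact le_of_eq (by ring)

end RunningTime

section Parameters

variable {V : Type*} [Fintype V] {G : RegularGraph V}

lemma opCost_le_four_mul_log (G : RegularGraph V) (hn : 1 < Fintype.card V) :
    (G.opCost : ℝ) ≤ 4 * Real.log (Fintype.card V) := by
  have hn' : (2 : ℝ) ≤ Fintype.card V := by exact_mod_cast hn
  have h_log_two := Real.log_two_gt_d9
  have h_log : Real.log 2 ≤ Real.log (Fintype.card V) := Real.log_le_log two_pos hn'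
  have h_pow : Nat.log 2 (Fintype.card V) * Real.log 2 ≤ Real.log (Fintype.card V) := by
    rw [← Real.log_pow]
    exact Real.log_le_log (by positivity) (by exact_mod_cast Nat.pow_log_le_self 2 (by omega))
  have h_nonneg : (0 : ℝ) ≤ Nat.log 2 (Fintype.card V) := Nat.cast_nonneg _
  rw [opCost, Nat.cast_add_one]
  nlinarith [h_log_two, h_log, h_pow, h_nonneg]

variable [DecidableEq V] {A : Finset V}

lemma nonempty_of_expansion_pos (hφ : 0 < G.expansion A) : A.Nonempty := by
  rw [Finset.nonempty_iff_ne_empty]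
  rintro rfl
  simp [expansion] at hφ

lemma card_lt_card_of_expansion_pos (hφ : 0 < G.expansion A) : A.card < Fintype.card V := by
  refine lt_of_le_of_ne A.card_le_univ fun h => ?_
  rw [Finset.card_eq_iff_eq_univ] at h
  simp [h, expansion, weight] at hφ

lemma one_lt_card_of_expansion_pos (hφ : 0 < G.expansion A) : 1 < Fintype.card V :=
  lt_of_le_of_lt (nonempty_of_expansion_pos hφ).card_pos (card_lt_card_of_expansion_pos hφ)

lemma one_le_card_of_expansion_pos (hφ : 0 < G.expansion A) : (1 : ℝ) ≤ A.card := by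
  exact_mod_cast (nonempty_of_expansion_pos hφ).card_pos

lemma half_le_log_card_of_expansion_pos (hφ : 0 < G.expansion A) :
    1 / 2 ≤ Real.log (Fintype.card V) := by
  have h := Real.log_le_log two_pos
    (show (2 : ℝ) ≤ Fintype.card V by exact_mod_cast one_lt_card_of_expansion_pos hφ)
  linarith [Real.log_two_gt_d9]

variable (G) in
/-- The number of steps of a copy for the target set `A`, with the constant `c = 1 / 16`. -/
def stepCount (A : Finset V) (ε : ℝ) : ℕ :=
  ⌈1 / 16 * (1 + ε * Real.log A.card) / G.expansion A⌉₊

variable (G) in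
/-- The running time of the theorem for the target set `A`, without its constant factor. -/
def timeScale (A : Finset V) (ε : ℝ) : ℝ :=
  G.maxDeg * (A.card : ℝ) ^ (1 + 2 * ε) * G.expansion A ^ (-(1 / 2) : ℝ) *
    Real.log (Fintype.card V) ^ 2

variable {ε ε₀ C : ℝ}

lemma le_expansion_mul_stepCount (hφ : 0 < G.expansion A) (ε : ℝ) :
    1 / 16 * (1 + ε * Real.log A.card) ≤ G.expansion A * G.stepCount A ε :=
  (div_le_iff₀' hφ).1 (Nat.le_ceil _)

lemma IsLazy.expansion_mul_stepCount_le (hG : G.IsLazy) (hφ : 0 < G.expansion A) (hε : 0 ≤ ε) :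
    G.expansion A * G.stepCount A ε ≤ 1 / 16 * (9 + ε * Real.log A.card) := by
  have := Real.log_natCast_nonneg A.card
  calc G.expansion A * G.stepCount A ε
      ≤ G.expansion A * (1 / 16 * (1 + ε * Real.log A.card) / G.expansion A + 1) := by
        gcongr
        exact (Nat.ceil_lt_add_one (by positivity)).le
    _ = 1 / 16 * (1 + ε * Real.log A.card) + G.expansion A := by
        rw [mul_add, mul_div_cancel₀ _ hφ.ne', mul_one]
    _ ≤ 1 / 16 * (9 + ε * Real.log A.card) := by linarith [hG.expansion_le_half A]

lemma IsLazy.exists_subset_rpow_le_stayProb (hG : G.IsLazy) (hφ : 0 < G.expansion A)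
    (hε : 0 ≤ ε) :
    ∃ A' ⊆ A, A.card ≤ 2 * A'.card ∧ ∀ v ∈ A',
      Real.exp (-9) / 8 * (A.card : ℝ) ^ (-ε) ≤ G.stayProb A (G.stepCount A ε) v := by
  obtain ⟨A', hA', h_card, h_stay⟩ := hG.exists_subset_exp_le_stayProb hφ (G.stepCount A ε)
  refine ⟨A', hA', h_card, fun v hv => le_trans ?_ (h_stay v hv)⟩
  rw [div_mul_eq_mul_div, Real.rpow_def_of_pos (by linarith [one_le_card_of_expansion_pos hφ]),
    ← Real.exp_add]
  gcongr
  linarith [hG.expansion_mul_stepCount_le hφ hε]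

lemma IsLazy.runCopy_singleton_toOuterMeasure_none_le (hG : G.IsLazy) (hφ : 0 < G.expansion A)
    (hC : 1 ≤ C) (hε : 0 < ε) (v : V) :
    (G.runCopy (C * (A.card : ℝ) ^ (1 + ε)) (C * G.expansion A / ε) (G.stepCount A ε)
      {v}).toOuterMeasure {r | r.1 = none} ≤
      ENNReal.ofReal (1 - G.stayProb A (G.stepCount A ε) v +
        (A.card / (C * (A.card : ℝ) ^ (1 + ε)) + √(C * (A.card : ℝ) ^ (1 + ε)) *
          Real.exp (-(1 / 384 * C * (1 / ε + Real.log A.card))))) := by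
  have hK : 1 ≤ C * (A.card : ℝ) ^ (1 + ε) := one_le_mul_of_one_le_of_one_le hC
    (Real.one_le_rpow (one_le_card_of_expansion_pos hφ) (by linarith))
  refine (hG.runCopy_toOuterMeasure_none_le A (by linarith) _ _ (Finset.singleton_nonempty v)
    (by simpa using hK)).trans (ENNReal.ofReal_le_ofReal ?_)
  have h_exponent : 1 / 384 * C * (1 / ε + Real.log A.card) ≤
      C * G.expansion A / ε * G.stepCount A ε / 24 := by
    calc 1 / 384 * C * (1 / ε + Real.log A.card)
        = C / ε * (1 / 16 * (1 + ε * Real.log A.card)) / 24 := by field_simp; ring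
      _ ≤ C / ε * (G.expansion A * G.stepCount A ε) / 24 := by
          gcongr C / ε * ?_ / 24
          exact le_expansion_mul_stepCount hφ ε
      _ = _ := by ring
  simp only [failureBound, Finset.sum_singleton, Finset.card_singleton, Nat.cast_one, div_one]
  rw [add_assoc]
  gcongr

lemma IsLazy.evolvingSetAlgorithm_toOuterMeasure_none_le_half (hG : G.IsLazy)
    (hφ : 0 < G.expansion A) (hε : 0 < ε) {p₀ : ℝ} (hp₀ : 0 ≤ p₀) (hC : 1 ≤ C) (hCp : 1 ≤ C * p₀)
    (h_error : A.card / (C * (A.card : ℝ) ^ (1 + ε)) + √(C * (A.card : ℝ) ^ (1 + ε)) *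
      Real.exp (-(1 / 384 * C * (1 / ε + Real.log A.card))) ≤ p₀ * (A.card : ℝ) ^ (-ε))
    {v : V} (hv : 2 * p₀ * (A.card : ℝ) ^ (-ε) ≤ G.stayProb A (G.stepCount A ε) v) :
    (G.evolvingSetAlgorithm (1 / 16) C v A.card (G.expansion A) ε).toOuterMeasure
      {r | r.1 = none} ≤ ENNReal.ofReal (1 / 2) := by
  have hk : (0 : ℝ) < A.card := zero_lt_one.trans_le (one_le_card_of_expansion_pos hφ)
  have h_copies : 1 ≤ ⌈C * (A.card : ℝ) ^ ε⌉₊ * (p₀ * (A.card : ℝ) ^ (-ε)) := by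
    calc 1 ≤ C * p₀ := hCp
      _ = C * (A.card : ℝ) ^ ε * (p₀ * (A.card : ℝ) ^ (-ε)) := by
          rw [Real.rpow_neg hk.le]
          field_simp
      _ ≤ _ := by
          gcongr
          exact Nat.le_ceil _
  rw [evolvingSetAlgorithm, runCopies_toOuterMeasure_none]
  refine le_trans ?_ (ofReal_one_sub_pow_le_half h_copies)
  gcongr
  refine (hG.runCopy_singleton_toOuterMeasure_none_le hφ hC hε v).trans
    (ENNReal.ofReal_le_ofReal ?_)
  linarith

lemma IsLazy.changeBound_stepCount_le (hG : G.IsLazy) (hφ : 0 < G.expansion A) (hε : 0 ≤ ε)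
    (hεε₀ : ε ≤ ε₀) (v : V) :
    changeBound √(G.expansion A) (G.stepCount A ε) {v} ≤
      (14 + ε₀) * (Real.log (Fintype.card V) / √(G.expansion A)) := by
  have h_log : ε * Real.log A.card ≤ ε₀ * Real.log (Fintype.card V) :=
    mul_le_mul hεε₀ (log_card_le_log_card A) (Real.log_natCast_nonneg _) (hε.trans hεε₀)
  have h_steps := hG.expansion_mul_stepCount_le hφ hε
  have h_half := half_le_log_card_of_expansion_pos hφ
  have h_nonneg : 0 ≤ ε₀ * Real.log (Fintype.card V) :=
    mul_nonneg (hε.trans hεε₀) (Real.log_natCast_nonneg _)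
  have h_sqrt := Real.sqrt_pos.2 hφ
  rw [← mul_div_assoc, le_div_iff₀ h_sqrt]
  calc changeBound √(G.expansion A) (G.stepCount A ε) {v} * √(G.expansion A)
      = √(G.expansion A) ^ 2 * G.stepCount A ε + 12 * Real.log (Fintype.card V) := by
        simp only [changeBound, Finset.card_singleton, Nat.cast_one, Real.log_one, sub_zero]
        field_simp
    _ ≤ (14 + ε₀) * Real.log (Fintype.card V) := by
        rw [Real.sq_sqrt hφ.le]
        linarith

lemma IsLazy.copyCost_le (hG : G.IsLazy) (hφ : 0 < G.expansion A) (hε : 0 ≤ ε) (hεε₀ : ε ≤ ε₀)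
    {K : ℝ} (hK : 1 ≤ K) (v : V) :
    G.opCost * (1 + G.deg v) + (G.opCost + 2 * G.opCost * G.maxDeg * K *
      changeBound √(G.expansion A) (G.stepCount A ε) {v}) ≤
      4 * (34 + 2 * ε₀) *
        (G.maxDeg * K * (Real.log (Fintype.card V) ^ 2 / √(G.expansion A))) := by
  set L := Real.log (Fintype.card V)
  set Δ : ℝ := (G.maxDeg : ℝ)
  set c : ℝ := (G.opCost : ℝ)
  have hΔ : 1 ≤ Δ := Nat.one_le_cast.2 (hG.one_le_maxDeg v)
  have h_deg : (G.deg v : ℝ) ≤ Δ := Nat.cast_le.2 (G.deg_le_maxDeg v)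
  have hc : 0 ≤ c := Nat.cast_nonneg _
  have h_half : 1 / 2 ≤ L := half_le_log_card_of_expansion_pos hφ
  have h_ratio : 1 ≤ K * (2 * (L / √(G.expansion A))) := by
    refine one_le_mul_of_one_le_of_one_le hK ?_
    rw [← mul_div_assoc, one_le_div (Real.sqrt_pos.2 hφ)]
    exact (Real.sqrt_le_one.2 (by linarith [hG.expansion_le_half A])).trans (by linarith)
  have h_change := hG.changeBound_stepCount_le hφ hε hεε₀ v
  calc c * (1 + G.deg v) + (c + 2 * c * Δ * K *
        changeBound √(G.expansion A) (G.stepCount A ε) {v})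
      ≤ c * (Δ + Δ) + (c * Δ + 2 * c * Δ * K * ((14 + ε₀) * (L / √(G.expansion A)))) := by
        gcongr
        exact le_mul_of_one_le_right hc hΔ
    _ = 3 * (c * Δ) * 1 + (28 + 2 * ε₀) * (c * Δ * K * (L / √(G.expansion A))) := by ring
    _ ≤ 3 * (c * Δ) * (K * (2 * (L / √(G.expansion A)))) +
        (28 + 2 * ε₀) * (c * Δ * K * (L / √(G.expansion A))) := by gcongr
    _ = (34 + 2 * ε₀) * (c * Δ * K * (L / √(G.expansion A))) := by ring
    _ ≤ (34 + 2 * ε₀) * (4 * L * Δ * K * (L / √(G.expansion A))) := by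
        gcongr
        · linarith
        · exact G.opCost_le_four_mul_log (one_lt_card_of_expansion_pos hφ)
    _ = _ := by ring

lemma IsLazy.pmfMean_evolvingSetAlgorithm_le (hG : G.IsLazy) (hφ : 0 < G.expansion A)
    (hε : 0 < ε) (hεε₀ : ε ≤ ε₀) (hC : 1 ≤ C) (v : V) :
    pmfMean (G.evolvingSetAlgorithm (1 / 16) C v A.card (G.expansion A) ε)
      (fun r => ENNReal.ofReal r.2) ≤
      ENNReal.ofReal (8 * C ^ 2 * (34 + 2 * ε₀) * G.timeScale A ε) := by
  have hk := one_le_card_of_expansion_pos hφ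
  set k : ℝ := (A.card : ℝ)
  set K := C * k ^ (1 + ε)
  have hK : 1 ≤ K := one_le_mul_of_one_le_of_one_le hC (Real.one_le_rpow hk (by linarith))
  have h_count : (⌈C * k ^ ε⌉₊ : ℝ) ≤ 2 * (C * k ^ ε) :=
    Nat.ceil_le_two_mul ((by norm_num : (2 : ℝ)⁻¹ ≤ 1).trans
      (one_le_mul_of_one_le_of_one_le hC (Real.one_le_rpow hk hε.le)))
  have h_change := changeBound_nonneg (Real.sqrt_nonneg (G.expansion A)) (G.stepCount A ε) {v}
  have h_scale : k ^ ε * k ^ (1 + ε) / √(G.expansion A) =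
      k ^ (1 + 2 * ε) * G.expansion A ^ (-(1 / 2) : ℝ) := by
    rw [← Real.rpow_add (by linarith), Real.rpow_neg hφ.le, ← Real.sqrt_eq_rpow]
    ring_nf
  simp only [ENNReal.ofReal_natCast]
  refine (G.pmfMean_runCopies_le K _ (G.stepCount A ε) v _).trans ?_
  grw [hG.pmfMean_runCopy_le (by linarith) _ (Real.sqrt_pos.2 hφ) _ (Finset.singleton_nonempty v)]
  rw [← ENNReal.ofReal_natCast, ← ENNReal.ofReal_natCast,
    ← ENNReal.ofReal_add (by positivity) (by positivity), ← ENNReal.ofReal_mul (by positivity)]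
  refine ENNReal.ofReal_le_ofReal ?_
  push_cast
  calc _ ≤ 2 * (C * k ^ ε) * (4 * (34 + 2 * ε₀) *
        (G.maxDeg * K * (Real.log (Fintype.card V) ^ 2 / √(G.expansion A)))) :=
        mul_le_mul h_count (hG.copyCost_le hφ hε.le hεε₀ hK v) (by positivity) (by positivity)
    _ = 8 * C ^ 2 * (34 + 2 * ε₀) * (G.maxDeg * (k ^ ε * k ^ (1 + ε) / √(G.expansion A)) *
        Real.log (Fintype.card V) ^ 2) := by ring
    _ = _ := by rw [h_scale, timeScale, ← mul_assoc (G.maxDeg : ℝ)]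

lemma IsLazy.timeScale_pos (hG : G.IsLazy) (hφ : 0 < G.expansion A) (ε : ℝ) :
    0 < G.timeScale A ε := by
  obtain ⟨v, _⟩ := nonempty_of_expansion_pos hφ
  have h_deg : (0 : ℝ) < G.maxDeg := Nat.cast_pos.2 (hG.one_le_maxDeg v)
  have h_card := one_le_card_of_expansion_pos hφ
  have h_log := half_le_log_card_of_expansion_pos hφ
  unfold timeScale
  positivity

end Parameters

end RegularGraph
end

theorem corollary1p5 (ε₀ : ℝ) (hε₀ : 0 < ε₀) :
    ∃ c C D p : ℝ, 0 < c ∧ 0 < C ∧ 0 < D ∧ 0 < p ∧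
      ∀ (V : Type*) [Fintype V] [DecidableEq V] (G : RegularGraph V), G.IsLazy →
      ∀ A : Finset V, A.Nonempty → 0 < G.expansion A →
      ∀ ε : ℝ, 0 < ε → ε ≤ ε₀ →
      ∃ A' : Finset V, A' ⊆ A ∧ (A.card : ℝ) / 2 ≤ (A'.card : ℝ) ∧
        ∀ v ∈ A',
          ENNReal.ofReal p ≤
            (G.evolvingSetAlgorithm c C v A.card (G.expansion A) ε).toOuterMeasure
              {r | ∃ S : Finset V, r.1 = some S ∧ S.Nonempty ∧
                G.Psi S ≤ C * G.expansion A / ε ∧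
                (S.card : ℝ) ≤ C * (A.card : ℝ) ^ (1 + ε) ∧
                (r.2 : ℝ) ≤ D * (G.maxDeg : ℝ) * (A.card : ℝ) ^ (1 + 2 * ε) *
                  (G.expansion A) ^ (-(1 / 2) : ℝ) *
                  Real.log (Fintype.card V) ^ 2} := by
  obtain ⟨C, hC, hCp, h_error⟩ := exists_forall_div_add_sqrt_mul_exp_le hε₀
    (show 0 < Real.exp (-9) / 16 by positivity) (show (0 : ℝ) < 1 / 384 by norm_num)
  refine ⟨1 / 16, C, 4 * (8 * C ^ 2 * (34 + 2 * ε₀)), 1 / 4, by norm_num, by linarith,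
    by positivity, by norm_num, fun V _ _ G hG A _ hφ ε hε hεε₀ => ?_⟩
  obtain ⟨A', hA', h_card, h_stay⟩ := hG.exists_subset_rpow_le_stayProb hφ hε.le
  refine ⟨A', hA', by rify at h_card; linarith, fun v hv => ?_⟩
  have h_none := hG.evolvingSetAlgorithm_toOuterMeasure_none_le_half (v := v) hφ hε
    (by positivity) hC hCp
    (h_error A.card ε (RegularGraph.one_le_card_of_expansion_pos hφ) hε hεε₀)
    (by linarith [h_stay v hv])
  have h_slow := toOuterMeasure_lt_le_ofReal_inv _
    (mul_pos (by positivity) (hG.timeScale_pos hφ ε)) four_pos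
    (hG.pmfMean_evolvingSetAlgorithm_le hφ hε hεε₀ hC v)
  convert ofReal_one_sub_sub_le_toOuterMeasure _ (by norm_num) (by norm_num) ?_ h_none h_slow
    using 2
  · norm_num
  rintro ⟨_ | S, m⟩ hr
  · exact .inr (.inl rfl)
  obtain ⟨hS, hSK, hΨ⟩ := G.runCopies_mem_support hr
  refine (le_or_gt (m : ℝ) _).imp (fun hm => ⟨S, rfl, hS, hΨ, hSK, hm.trans_eq ?_⟩) .inr
  rw [RegularGraph.timeScale]
  ring
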